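/- For real $x,y,z$ let $$Q(x,y,z)=\int_{-\infty}^{\infty}\exp\!\big[i(\tfrac15t^5+\tfrac13xt^3+\tfrac12yt^2+zt)\big]\,dt$$ be the (rescaled) swallowtail integral, understood as a convergent improper integral, i.e. as the limit of $\int_a^b$ as $a\to-\infty$, $b\to+\infty$ independently. Let $f(t)=\tfrac15t^5+t$, $t_k=i^k e^{\pi i/4}$, and for $z>0$ write $\lambda=z^{5/4}$. (1) For every $z>0$ the integral defining $Q(0,0,z)$ converges. (2) The saddle points of $f$ (the zeroes of $f'$ in $\mathbb C$) are exactly $t_0,t_1,t_2,t_3$. (3) The two saddles $t_0=e^{\pi i/4}$ and $t_1=e^{3\pi i/4}$ contribute to $Q(0,0,z)$: there are paths of steepest descent $\Gamma_1$, $\Gamma_0$ of $e^{i\lambda f}$ through $t_1$ and $t_0$ respectively (regular $C^1$ curves along which $\operatorname{Im}(if)$ is constant and $\operatorname{Re}(if)$ strictly decreases on moving away from the saddle in either direction), where $\Gamma_1$ runs from $\infty e^{9\pi i/10}$ to $\infty i$ and $\Gamma_0$ from $\infty i$ to $\infty e^{\pi i/10}$, such that the integrals of $e^{i\lambda f}$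 along them converge absolutely for every $\lambda>0$, $$Q(0,0,z)=z^{1/4}\Big(\int_{\Gamma_1}e^{i\lambda f(t)}dt+\int_{\Gamma_0}e^{i\lambda f(t)}dt\Big)\qquad(z>0),$$ and, for $k=0,1$, with principal square roots, $$\int_{\Gamma_k}e^{i\lambda f(t)}dt\sim e^{i\lambda f(t_k)}\sqrt{\frac{2i}{f''(t_k)}}\sqrt{\frac{\pi}{\lambda}}\qquad(\lambda\to+\infty).$$ (4) As $z\to+\infty$, $$Q(0,0,z)=z^{1/4}\sqrt{\frac{2\pi}{\lambda}}\;e^{-4\lambda/(5\sqrt2)}\Big[\cos\!\Big(\frac{4\lambda}{5\sqrt2}-\frac{\pi}{8}\Big)+o(1)\Big].$$ (5) The positive zeroes of $z\mapsto Q(0,0,z)$ form a strictly increasing infinite sequence $\zeta_0<\zeta_1<\zeta_2<\cdots$, and $$\zeta_m\sim\Big[\frac{5\sqrt2}{4}\Big(\frac{\pi}{8}+(2m+1)\frac{\pi}{2}\Big)\Big]^{4/5}\qquad(m\to\infty).$$ Moreover they are located, asymptotically, at the zeroes of the cosine: for every $0<\varepsilon<\pi/2$, for all sufficiently large $m$ there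 is exactly one zero $z>0$ of $Q(0,0,\cdot)$ with $\big|\tfrac{4}{5\sqrt2}z^{5/4}-\tfrac{\pi}{8}-(2m+1)\tfrac{\pi}{2}\big|<\varepsilon$, and every sufficiently large zero satisfies this inequality for some $m\in\{0,1,2,\dots\}$. -/

import Mathlib

open Filter Topology Asymptotics Set

/-- The truncated swallowtail integral
`∫_a^b exp(i (t⁵/5 + x t³/3 + y t²/2 + z t)) dt`. -/
noncomputable def swallowtailTrunc (x y z a b : ℝ) : ℂ :=
  ∫ t in a..b, Complex.exp (Complex.I *
    ((t ^ 5 / 5 + x * t ^ 3 / 3 + y * t ^ 2 / 2 + z * t : ℝ) : ℂ))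

/-- The rescaled swallowtail integral `Q(x,y,z)`: the integral over the real line is a conditionally
convergent improper integral, i.e. the limit of the integrals over `[a, b]` as `a → -∞` and
`b → +∞` independently. -/
noncomputable def swallowtailQ (x y z : ℝ) : ℂ :=
  limUnder (atBot ×ˢ atTop) (fun p : ℝ × ℝ => swallowtailTrunc x y z p.1 p.2)

/-- The phase `f₊(t) = t⁵/5 + t`. -/
noncomputable def phasePlus (t : ℂ) : ℂ := t ^ 5 / 5 + t

/-- The points `t_k = i^k e^{πi/4}`. -/
noncomputable def saddlePlus (k : ℕ) : ℂ :=
  Complex.I ^ k * Complex.exp (Real.pi * Complex.I / 4)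

/-- `γ` is a (regular, `C¹`) parametrisation of a path of steepest descent of `exp (lam * φ)`,
`lam > 0`, through `p`: the imaginary part of `φ` is constant along the path, and its real part
strictly decreases along the path on moving away from `p` in either direction. -/
structure IsSteepestDescentPath (φ : ℂ → ℂ) (p : ℂ) (γ : ℝ → ℂ) : Prop where
  contDiff : ContDiff ℝ 1 γ
  regular : ∀ s, deriv γ s ≠ 0
  through : γ 0 = p
  im_const : ∀ s, (φ (γ s)).im = (φ p).im
  re_mono : StrictMonoOn (fun s => (φ (γ s)).re) (Iic 0)
  re_anti : StrictAntiOn (fun s => (φ (γ s)).re) (Ici 0)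

/-- The path `γ` tends to `∞ e^{iα}` along the filter `l` (for `α` in `(-π, π)`). -/
def TendsToInftyDir (γ : ℝ → ℂ) (l : Filter ℝ) (α : ℝ) : Prop :=
  Tendsto (fun s => ‖γ s‖) l atTop ∧ Tendsto (fun s => (γ s).arg) l (𝓝 α)

/-- The integrand of `∫_γ exp(i lam f₊(t)) dt`, pulled back to the parameter line. -/
noncomputable def pathIntegrand (γ : ℝ → ℂ) (lam : ℝ) (s : ℝ) : ℂ :=
  Complex.exp (Complex.I * lam * phasePlus (γ s)) * deriv γ s

/-- The contour integral `∫_γ exp(i lam f₊(t)) dt`. -/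
noncomputable def pathIntegral (γ : ℝ → ℂ) (lam : ℝ) : ℂ :=
  ∫ s, pathIntegrand γ lam s

/-- The leading contribution `e^{i lam f₊(p)} √(2i / f₊''(p)) √(π / lam)` of a saddle `p`
(principal square roots). -/
noncomputable def saddleContribution (p : ℂ) (lam : ℝ) : ℂ :=
  Complex.exp (Complex.I * lam * phasePlus p) *
    (2 * Complex.I / iteratedDeriv 2 phasePlus p) ^ (1 / 2 : ℂ) * (√(Real.pi / lam) : ℂ)

/-- The amplitude `z^{1/4} √(2π/λ) e^{-4λ/(5√2)}`, where `λ = z^{5/4}`. -/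
noncomputable def amplitudePlus (z : ℝ) : ℝ :=
  z ^ (1 / 4 : ℝ) * √(2 * Real.pi / z ^ (5 / 4 : ℝ)) *
    Real.exp (-(4 * z ^ (5 / 4 : ℝ) / (5 * √2)))

/-- The argument `4λ/(5√2) - π/8` of the cosine, where `λ = z^{5/4}`. -/
noncomputable def anglePlus (z : ℝ) : ℝ :=
  4 * z ^ (5 / 4 : ℝ) / (5 * √2) - Real.pi / 8

/-- The approximate zeroes `[(5√2/4) (π/8 + (2m+1)π/2)]^{4/5}`. -/
noncomputable def approxZeroPlus (m : ℕ) : ℝ :=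
  (5 * √2 / 4 * (Real.pi / 8 + (2 * m + 1) * Real.pi / 2)) ^ (4 / 5 : ℝ)

/-! Write t = u + iv. The equation Re f = Re f(t_0) is quadratic in v², so the steepest descent path
is explicit. With u = s/√2 its reduced discriminant is (s - 1)² (s² + 2s + 3 + 4/s)/5; the double
zero s = 1 is the saddle. Taking the root with the sign of s - 1 gives one smooth branch through it,
and s = e^σ parametrises the branch from ∞i to ∞e^{πi/10}. The sign of the derivative of Im f along
it comes from `hasDerivAt_phasePlus_descentCurve_im`. Since f(-conj t) = -conj f(t), the mirror
image of this path serves t_1, with the conjugate integral.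

The contour is deformed through a primitive G of the integrand. At its right end the curve is joined
to the real axis by vertical segments whose contribution vanishes; at its left end it approaches the
imaginary axis, where G is purely imaginary. With the symmetry G(-x) = -conj G(x) this proves
convergence and gives Q as twice the real part of the integral along one curve
(`tendsto_integral_quinticExp`). Scaling t by z^{1/4} brings in λ = z^{5/4}.

On the curve f = f(t_0) + ih with h ≥ 0, and 5h = |t - t_0|² times the modulus of a cubic that does
not vanish there. Hence h ≥ cσ² globally, and Laplace's method is dominated convergence after σ =
x/√λ (`tendsto_laplace_descentHeight`). The result is Q = amplitude · Re(e^{iα} K(λ)) with K → 1,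
where α is the angle of the cosine.

Zeros near those of the cosine come from sign changes. Uniqueness holds because K varies slowly: two
zeros in one window would make the cosine difference o(1)·|Δα|, whereas it is at least a constant
times |Δα|. Q is the restriction of a function analytic on the whole real line, so its zeros do not
accumulate at a finite point and can be enumerated. Eventually each window holds one zero, so the
index of the window differs from that of the zero by a constant, which does not affect the
asymptotics. -/

/-! ### The explicit curve and lower bounds for its squared ordinate. -/

/-- The square root in the equation of the steepest descent curve. -/
noncomputable def descentRad (s : ℝ) : ℝ := √((s ^ 2 + 2 * s + 3 + 4 / s) / 5)

/-- The squared ordinate of the point with abscissa `s / √2` on the steepest descent curve. -/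
noncomputable def descentSq (s : ℝ) : ℝ := s ^ 2 / 2 - (s - 1) * descentRad s

/-- The steepest descent curve through `e^{πi/4}`. -/
noncomputable def descentCurve (σ : ℝ) : ℂ :=
  ((Real.exp σ / √2 : ℝ) : ℂ) + ((√(descentSq (Real.exp σ)) : ℝ) : ℂ) * Complex.I

lemma descentCurve_re (σ : ℝ) : (descentCurve σ).re = Real.exp σ / √2 := by
  rw [descentCurve, Complex.add_re, Complex.re_ofReal_mul, Complex.ofReal_re, Complex.I_re,
    mul_zero, add_zero]

lemma descentCurve_im (σ : ℝ) : (descentCurve σ).im = √(descentSq (Real.exp σ)) := by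
  simp [descentCurve]

section
variable {s : ℝ} (hs : 0 < s)
include hs

lemma descentRad_arg_pos : 0 < (s ^ 2 + 2 * s + 3 + 4 / s) / 5 := by positivity

lemma descentRad_pos : 0 < descentRad s := Real.sqrt_pos.2 (descentRad_arg_pos hs)

lemma sq_descentRad : descentRad s ^ 2 = (s ^ 2 + 2 * s + 3 + 4 / s) / 5 :=
  Real.sq_sqrt (descentRad_arg_pos hs).le

lemma descentRad_lower_of_le_one (h1 : s ≤ 1) : 1 ≤ descentRad s := by
  refine Real.one_le_sqrt.2 ?_
  have : 1 ≤ 1 / s := by rw [le_div_iff₀ hs]; linarith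
  have h4 : 4 / s = 4 * (1 / s) := by ring
  rw [h4]; nlinarith [sq_nonneg s]

/-- For s ≥ 1 the definition is a difference of positive terms of the same order. Multiplying by the
conjugate sum turns it into the polynomial s⁵ + 20s - 16, which exceeds s⁵ on this range. -/
lemma descentSq_lower_of_one_le (h1 : 1 ≤ s) : s ^ 2 / 40 ≤ descentSq s := by
  have h2 : descentRad s ^ 2 ≤ 2 * s ^ 2 := by
    rw [sq_descentRad hs]
    have : 4 / s ≤ 4 := by rw [div_le_iff₀ hs]; linarith
    nlinarith
  have hr := descentRad_pos hs
  have h3 : descentRad s ≤ 3 / 2 * s := by nlinarith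
  have h4 : s * descentRad s ^ 2 * 5 = s ^ 3 + 2 * s ^ 2 + 3 * s + 4 := by
    rw [sq_descentRad hs]; field_simp
  have h5 : descentSq s * (s ^ 2 / 2 + (s - 1) * descentRad s) * (20 * s)
      = s ^ 5 + 20 * s - 16 := by
    unfold descentSq
    have : (s ^ 2 / 2 - (s - 1) * descentRad s) * (s ^ 2 / 2 + (s - 1) * descentRad s) * (20 * s)
      = 5 * s ^ 5 - 4 * (s - 1) ^ 2 * (s * descentRad s ^ 2 * 5) := by ring
    rw [this, h4]; ring
  have h6 : s ^ 2 / 2 + (s - 1) * descentRad s ≤ 2 * s ^ 2 := by nlinarith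
  have h7 : 0 < s ^ 2 / 2 + (s - 1) * descentRad s := by
    have : 0 ≤ (s - 1) * descentRad s := mul_nonneg (by linarith) hr.le
    positivity
  by_contra! hc
  have h8 : descentSq s * (s ^ 2 / 2 + (s - 1) * descentRad s) ≤ s ^ 2 / 40 * (2 * s ^ 2) := by
    by_cases h0 : 0 ≤ descentSq s
    · exact mul_le_mul hc.le h6 h7.le (by positivity)
    · have := mul_neg_of_neg_of_pos (not_le.1 h0) h7
      have : 0 ≤ s ^ 2 / 40 * (2 * s ^ 2) := by positivity
      linarith
  have h9 := mul_le_mul_of_nonneg_right h8 (by positivity : 0 ≤ 20 * s)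
  rw [h5] at h9
  nlinarith

lemma descentSq_lower_of_le_one (h1 : s ≤ 1) : 1 / 8 ≤ descentSq s := by
  have h := descentRad_lower_of_le_one hs h1
  unfold descentSq
  nlinarith [mul_le_mul_of_nonneg_left h (by linarith : 0 ≤ 1 - s), sq_nonneg (s - 1)]

lemma descentSq_lower : 1 / 40 ≤ descentSq s := by
  rcases le_total s 1 with h | h
  · linarith [descentSq_lower_of_le_one hs h]
  · have := descentSq_lower_of_one_le hs h
    nlinarith

lemma descentSq_pos : 0 < descentSq s := by linarith [descentSq_lower hs]

/-- This is the level equation Re f = 4/(5√2) after division by u and completion of the square in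
v². -/
lemma sq_descentSq_sub : (descentSq s - s ^ 2 / 2) ^ 2 = s ^ 4 / 5 - 1 + 4 / (5 * s) := by
  have : (descentSq s - s ^ 2 / 2) ^ 2 = (s - 1) ^ 2 * descentRad s ^ 2 := by
    unfold descentSq; ring
  rw [this, sq_descentRad hs]
  field_simp
  ring
end

/-! ### Real and imaginary parts of the phase, and its saddle points. -/

lemma phasePlus_re_im (t : ℂ) :
    (phasePlus t).re = t.re ^ 5 / 5 - 2 * t.re ^ 3 * t.im ^ 2 + t.re * t.im ^ 4 + t.re ∧
    (phasePlus t).im = t.re ^ 4 * t.im - 2 * t.re ^ 2 * t.im ^ 3 + t.im ^ 5 / 5 + t.im := by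
  have h : phasePlus t = ((t.re : ℂ) + t.im * Complex.I) ^ 5 / 5 + (t.re + t.im * Complex.I) := by
    rw [Complex.re_add_im]; rfl
  have h5 : ((t.re : ℂ) + t.im * Complex.I) ^ 5 / 5 + (t.re + t.im * Complex.I)
    = ((t.re ^ 5 / 5 - 2 * t.re ^ 3 * t.im ^ 2 + t.re * t.im ^ 4 + t.re : ℝ) : ℂ)
      + ((t.re ^ 4 * t.im - 2 * t.re ^ 2 * t.im ^ 3 + t.im ^ 5 / 5 + t.im : ℝ) : ℂ)
        * Complex.I := by
    push_cast
    linear_combination ((t.re : ℂ) * t.im ^ 4 * (Complex.I ^ 2 - 1) + 2 * t.re ^ 3 * t.im ^ 2 +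
      2 * t.re ^ 2 * t.im ^ 3 * Complex.I +
      (t.im : ℂ) ^ 5 / 5 * Complex.I * (Complex.I ^ 2 - 1)) * Complex.I_sq
  rw [h, h5]
  exact ⟨by rw [Complex.add_re, Complex.re_ofReal_mul, Complex.ofReal_re, Complex.I_re, mul_zero, add_zero], by rw [Complex.add_im, Complex.im_ofReal_mul, Complex.ofReal_im, Complex.I_im, mul_one, zero_add]⟩

lemma phasePlus_re (t : ℂ) : (phasePlus t).re =
    t.re ^ 5 / 5 - 2 * t.re ^ 3 * t.im ^ 2 + t.re * t.im ^ 4 + t.re := (phasePlus_re_im t).1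

lemma phasePlus_im (t : ℂ) : (phasePlus t).im =
    t.re ^ 4 * t.im - 2 * t.re ^ 2 * t.im ^ 3 + t.im ^ 5 / 5 + t.im := (phasePlus_re_im t).2

lemma saddlePlus_zero_eq : saddlePlus 0 = ((1 / √2 : ℝ) : ℂ) + ((1 / √2 : ℝ) : ℂ) * Complex.I := by
  have h : (Real.pi : ℂ) * Complex.I / 4 = ((Real.pi / 4 : ℝ) : ℂ) * Complex.I := by
    push_cast; ring
  have h2 : √2 / 2 = 1 / √2 := by
    rw [div_eq_div_iff (by norm_num) (by positivity)]; norm_num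
  rw [saddlePlus, h, Complex.exp_mul_I, ← Complex.ofReal_cos, ← Complex.ofReal_sin,
    Real.cos_pi_div_four, Real.sin_pi_div_four, h2]
  simp

lemma saddlePlus_one_eq : saddlePlus 1 = Complex.I * saddlePlus 0 := by
  simp [saddlePlus]

lemma saddlePlus_zero_pow_four : saddlePlus 0 ^ 4 = -1 := by
  rw [saddlePlus, pow_zero, one_mul, ← Complex.exp_nat_mul]
  rw [← Complex.exp_pi_mul_I]; congr 1; push_cast; field_simp

lemma hasDerivAt_phasePlus (t : ℂ) : HasDerivAt phasePlus (t ^ 4 + 1) t := by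
  have := ((hasDerivAt_pow 5 t).div_const 5).add (hasDerivAt_id t)
  refine HasDerivAt.congr_deriv (f := phasePlus) this ?_
  push_cast; ring

lemma deriv_phasePlus_eq_zero_iff (t : ℂ) :
    deriv phasePlus t = 0 ↔ ∃ k < 4, t = saddlePlus k := by
  rw [(hasDerivAt_phasePlus t).deriv]
  set p := saddlePlus 0 with hp
  have hk : ∀ k, saddlePlus k = Complex.I ^ k * p := by intro k; simp [hp, saddlePlus]
  have h : t ^ 4 + 1 = (t - p) * (t - Complex.I * p) * (t + p) * (t + Complex.I * p) := by
    linear_combination saddlePlus_zero_pow_four +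
      (t ^ 2 * p ^ 2 - p ^ 4) * Complex.I_sq
  constructor
  · intro h0
    rw [h] at h0
    simp only [mul_eq_zero] at h0
    rcases h0 with ((h0 | h0) | h0) | h0
    · exact ⟨0, by norm_num, by rw [hk]; linear_combination h0⟩
    · exact ⟨1, by norm_num, by rw [hk]; linear_combination h0⟩
    · exact ⟨2, by norm_num, by rw [hk]; linear_combination h0 - p * Complex.I_sq⟩
    · exact ⟨3, by norm_num, by
        rw [hk]; linear_combination h0 - Complex.I * p * Complex.I_sq⟩
  · rintro ⟨k, -, rfl⟩
    rw [hk, mul_pow, ← pow_mul, mul_comm k, pow_mul, Complex.I_pow_four, one_pow,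
      saddlePlus_zero_pow_four]
    norm_num

lemma descentCurve_zero : descentCurve 0 = saddlePlus 0 := by
  rw [saddlePlus_zero_eq, descentCurve]
  have : descentSq 1 = 1 / 2 := by norm_num [descentSq]
  simp [this]

lemma phasePlus_descentCurve_re (σ : ℝ) :
    (phasePlus (descentCurve σ)).re = 4 / (5 * √2) := by
  rw [phasePlus_re, descentCurve_re, descentCurve_im]
  have hs := Real.exp_pos σ
  set s := Real.exp σ
  set w := descentSq s with hw
  have h := sq_descentSq_sub hs
  rw [← hw] at h
  have h2 : √w ^ 2 = w := Real.sq_sqrt (descentSq_pos hs).le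
  have h4 : √w ^ 4 = w ^ 2 := by rw [show √w ^ 4 = (√w ^ 2) ^ 2 by ring, h2]
  rw [h2, h4]
  have hq : √2 ^ 2 = 2 := Real.sq_sqrt (by norm_num)
  have hq0 : √2 ≠ 0 := by positivity
  have e : w ^ 2 = s ^ 2 * w - s ^ 4 / 4 + (s ^ 4 / 5 - 1 + 4 / (5 * s)) := by
    rw [← h]; ring
  rw [e]
  have hs0 := hs.ne'
  have h3 : √2 ^ 3 = 2 * √2 := by rw [pow_succ, hq]
  have h5 : √2 ^ 5 = 4 * √2 := by
    rw [show √2 ^ 5 = (√2 ^ 2) ^ 2 * √2 by ring, hq]; norm_num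
  rw [div_pow, div_pow, h3, h5]
  field_simp
  ring

/-! ### Velocity of the curve and the steepest descent property. -/

/-- The derivative of `descentSq`. -/
noncomputable def descentSqDeriv (s : ℝ) : ℝ :=
  s - descentRad s - (s - 1) * ((2 * s + 2 - 4 / s ^ 2) / 5 / (2 * descentRad s))

/-- The velocity of `descentCurve`. -/
noncomputable def descentVel (σ : ℝ) : ℂ :=
  ((Real.exp σ / √2 : ℝ) : ℂ) +
    ((descentSqDeriv (Real.exp σ) * Real.exp σ / (2 * √(descentSq (Real.exp σ))) : ℝ) : ℂ)
      * Complex.I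

lemma descentVel_re (σ : ℝ) : (descentVel σ).re = Real.exp σ / √2 := by
  rw [descentVel, Complex.add_re, Complex.re_ofReal_mul, Complex.ofReal_re, Complex.I_re,
    mul_zero, add_zero]

lemma descentVel_im (σ : ℝ) : (descentVel σ).im =
    descentSqDeriv (Real.exp σ) * Real.exp σ / (2 * √(descentSq (Real.exp σ))) := by
  rw [descentVel, Complex.add_im, Complex.im_ofReal_mul, Complex.ofReal_im, Complex.I_im,
    mul_one, zero_add]

lemma hasDerivAt_descentSq {s : ℝ} (hs : 0 < s) :
    HasDerivAt descentSq (descentSqDeriv s) s := by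
  have h1 : HasDerivAt (fun s : ℝ => (s ^ 2 + 2 * s + 3 + 4 / s) / 5)
      ((2 * s + 2 - 4 / s ^ 2) / 5) s := by
    have := ((((hasDerivAt_pow 2 s).add ((hasDerivAt_id s).const_mul 2)).add_const 3).add
      ((hasDerivAt_inv hs.ne').const_mul 4)).div_const 5
    refine this.congr_deriv ?_
    push_cast; ring
  have h2 : HasDerivAt descentRad ((2 * s + 2 - 4 / s ^ 2) / 5 / (2 * descentRad s)) s :=
    h1.sqrt (descentRad_arg_pos hs).ne'
  have h3 := ((hasDerivAt_pow 2 s).div_const 2).sub (((hasDerivAt_id s).sub_const 1).mul h2)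
  refine HasDerivAt.congr_deriv (f := descentSq) h3 ?_
  simp only [descentSqDeriv, id]
  push_cast; ring

lemma hasDerivAt_descentCurve (σ : ℝ) : HasDerivAt descentCurve (descentVel σ) σ := by
  have h1 := ((Real.hasDerivAt_exp σ).div_const √2).ofReal_comp
  have h2 := (((hasDerivAt_descentSq (Real.exp_pos σ)).comp σ (Real.hasDerivAt_exp σ)).sqrt
    (descentSq_pos (Real.exp_pos σ)).ne').ofReal_comp
  exact h1.add (h2.mul_const Complex.I)

lemma deriv_descentCurve : deriv descentCurve = descentVel :=
  funext fun σ => (hasDerivAt_descentCurve σ).deriv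

lemma contDiff_descentCurve : ContDiff ℝ 1 descentCurve := by
  have h0 : ContDiff ℝ 1 (fun σ => (Real.exp σ ^ 2 + 2 * Real.exp σ + 3 + 4 / Real.exp σ) / 5) := by
    have : ContDiff ℝ 1 (fun σ => 4 / Real.exp σ) :=
      contDiff_const.div Real.contDiff_exp fun σ => (Real.exp_pos σ).ne'
    fun_prop
  have h1 : ContDiff ℝ 1 (fun σ => descentRad (Real.exp σ)) :=
    h0.sqrt fun σ => (descentRad_arg_pos (Real.exp_pos σ)).ne'
  have h2 : ContDiff ℝ 1 (fun σ => descentSq (Real.exp σ)) := by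
    unfold descentSq; fun_prop
  have h3 : ContDiff ℝ 1 (fun σ => √(descentSq (Real.exp σ))) :=
    h2.sqrt fun σ => (descentSq_pos (Real.exp_pos σ)).ne'
  have h4 : ContDiff ℝ 1 (fun σ => Real.exp σ / √2) := by fun_prop
  exact (Complex.ofRealCLM.contDiff.comp h4).add
    ((Complex.ofRealCLM.contDiff.comp h3).mul contDiff_const)

lemma continuous_descentCurve : Continuous descentCurve := contDiff_descentCurve.continuous

lemma continuous_descentVel : Continuous descentVel :=
  deriv_descentCurve ▸ contDiff_descentCurve.continuous_deriv le_rfl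

lemma descentVel_ne_zero (σ : ℝ) : descentVel σ ≠ 0 := by
  intro h
  have := descentVel_re σ
  rw [h, Complex.zero_re] at this
  have h2 : 0 < Real.exp σ / √2 := by positivity
  linarith

lemma descentCurve_im_pos (σ : ℝ) : 0 < (descentCurve σ).im := by
  rw [descentCurve_im]; exact Real.sqrt_pos.2 (descentSq_pos (Real.exp_pos σ))

lemma descentCurve_re_pos (σ : ℝ) : 0 < (descentCurve σ).re := by
  rw [descentCurve_re]; positivity

lemma sq_re_sub_sq_im_descentCurve (σ : ℝ) :
    (descentCurve σ).re ^ 2 - (descentCurve σ).im ^ 2 =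
      (Real.exp σ - 1) * descentRad (Real.exp σ) := by
  rw [descentCurve_re, descentCurve_im, Real.sq_sqrt (descentSq_pos (Real.exp_pos σ)).le,
    div_pow, Real.sq_sqrt (by norm_num : (0 : ℝ) ≤ 2), descentSq]
  ring

lemma hasDerivAt_phasePlus_descentCurve (σ : ℝ) :
    HasDerivAt (fun σ => phasePlus (descentCurve σ))
      ((descentCurve σ ^ 4 + 1) * descentVel σ) σ :=
  (hasDerivAt_phasePlus (descentCurve σ)).comp σ (hasDerivAt_descentCurve σ)

/-- Put f'(γ) = a + ib and γ' = p + iq. As Re f is constant, ap = bq, so p(aq + bp) = b|γ'|². The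
exponential parameter makes p = u, and b = Im t⁴ = 4uv(u² - v²); cancelling u leaves a formula whose
sign is that of e^σ - 1. -/
lemma hasDerivAt_phasePlus_descentCurve_im (σ : ℝ) :
    HasDerivAt (fun σ => (phasePlus (descentCurve σ)).im)
      (4 * (descentCurve σ).im * ((Real.exp σ - 1) * descentRad (Real.exp σ)) *
        Complex.normSq (descentVel σ)) σ := by
  have h := hasDerivAt_phasePlus_descentCurve σ
  have him := Complex.imCLM.hasFDerivAt.comp_hasDerivAt σ h
  have hre := Complex.reCLM.hasFDerivAt.comp_hasDerivAt σ h
  refine him.congr_deriv ?_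
  have h0 : ((descentCurve σ ^ 4 + 1) * descentVel σ).re = 0 := by
    refine hre.unique ?_
    have : (⇑Complex.reCLM ∘ fun σ => phasePlus (descentCurve σ)) = fun _ => 4 / (5 * √2) :=
      funext phasePlus_descentCurve_re
    rw [this]
    exact hasDerivAt_const _ _
  have hB : (descentCurve σ ^ 4 + 1).im = 4 * (descentCurve σ).re * (descentCurve σ).im *
      ((descentCurve σ).re ^ 2 - (descentCurve σ).im ^ 2) := by
    simp [pow_succ]; ring
  have hp : (descentVel σ).re = (descentCurve σ).re := by
    rw [descentVel_re, descentCurve_re]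
  rw [← sq_re_sub_sq_im_descentCurve, Complex.normSq_apply]
  change ((descentCurve σ ^ 4 + 1) * descentVel σ).im = _
  rw [Complex.mul_re] at h0
  rw [Complex.mul_im]
  -- Both sides are multiplied by u = p, so that ap = bq can be substituted.
  have hu := descentCurve_re_pos σ
  apply mul_left_cancel₀ hu.ne'
  linear_combination (descentVel σ).im * h0 -
    ((descentCurve σ ^ 4 + 1).re * (descentVel σ).im +
      (descentCurve σ ^ 4 + 1).im * (descentVel σ).re) * hp +
    ((descentVel σ).re * (descentVel σ).re + (descentVel σ).im * (descentVel σ).im) * hB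

lemma isSteepestDescentPath_descentCurve :
    IsSteepestDescentPath (fun t => Complex.I * phasePlus t) (saddlePlus 0) descentCurve where
  contDiff := contDiff_descentCurve
  regular s := by rw [deriv_descentCurve]; exact descentVel_ne_zero s
  through := descentCurve_zero
  im_const s := by
    simp only [Complex.I_mul_im, ← descentCurve_zero, phasePlus_descentCurve_re]
  re_mono := by
    simp only [Complex.I_mul_re]
    refine strictMonoOn_of_deriv_pos (convex_Iic 0)
      (fun σ _ => (hasDerivAt_phasePlus_descentCurve_im σ).neg.continuousAt.continuousWithinAt) ?_
    intro σ hσ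
    rw [interior_Iic, mem_Iio] at hσ
    rw [(hasDerivAt_phasePlus_descentCurve_im σ).fun_neg.deriv]
    have h1 := descentCurve_im_pos σ
    have h2 := descentRad_pos (Real.exp_pos σ)
    have h3 := Complex.normSq_pos.2 (descentVel_ne_zero σ)
    have h4 : 0 < 1 - Real.exp σ := by linarith [Real.exp_lt_one_iff.2 hσ]
    have : 0 < 4 * (descentCurve σ).im * ((1 - Real.exp σ) * descentRad (Real.exp σ)) *
        Complex.normSq (descentVel σ) := by positivity
    linarith
  re_anti := by
    simp only [Complex.I_mul_re]
    refine strictAntiOn_of_deriv_neg (convex_Ici 0)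
      (fun σ _ => (hasDerivAt_phasePlus_descentCurve_im σ).neg.continuousAt.continuousWithinAt) ?_
    intro σ hσ
    rw [interior_Ici, mem_Ioi] at hσ
    rw [(hasDerivAt_phasePlus_descentCurve_im σ).fun_neg.deriv]
    have h1 := descentCurve_im_pos σ
    have h2 := descentRad_pos (Real.exp_pos σ)
    have h3 := Complex.normSq_pos.2 (descentVel_ne_zero σ)
    have h4 : 0 < Real.exp σ - 1 := by linarith [Real.one_lt_exp_iff.2 hσ]
    have : 0 < 4 * (descentCurve σ).im * ((Real.exp σ - 1) * descentRad (Real.exp σ)) *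
        Complex.normSq (descentVel σ) := by positivity
    linarith

/-! ### The mirror image in the imaginary axis. -/

/-- The reflected curve, through `e^{3πi/4}`. -/
noncomputable def descentCurveRefl (σ : ℝ) : ℂ := -(starRingEnd ℂ) (descentCurve (-σ))

lemma phasePlus_neg_conj (t : ℂ) :
    phasePlus (-(starRingEnd ℂ) t) = -(starRingEnd ℂ) (phasePlus t) := by
  simp only [phasePlus, map_add, map_div₀, map_pow, map_ofNat]; ring

lemma saddlePlus_one_eq_refl : saddlePlus 1 = -(starRingEnd ℂ) (saddlePlus 0) := by
  rw [saddlePlus_one_eq, saddlePlus_zero_eq]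
  apply Complex.ext <;> simp

lemma hasDerivAt_descentCurveRefl (σ : ℝ) :
    HasDerivAt descentCurveRefl ((starRingEnd ℂ) (descentVel (-σ))) σ := by
  have h := (hasDerivAt_descentCurve (-σ)).scomp σ (hasDerivAt_neg σ)
  have h2 := (Complex.conjCLE.toContinuousLinearMap.hasFDerivAt.comp_hasDerivAt σ h).neg
  refine HasDerivAt.congr_deriv (f := descentCurveRefl) h2 ?_
  simp

lemma isSteepestDescentPath_descentCurveRefl :
    IsSteepestDescentPath (fun t => Complex.I * phasePlus t) (saddlePlus 1)
      descentCurveRefl where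
  contDiff := by
    have h : ContDiff ℝ 1 fun σ => descentCurve (-σ) := contDiff_descentCurve.comp contDiff_neg
    exact (Complex.conjCLE.toContinuousLinearMap.contDiff.comp h).neg
  regular s := by
    rw [(hasDerivAt_descentCurveRefl s).deriv]
    simpa using descentVel_ne_zero (-s)
  through := by
    rw [descentCurveRefl, neg_zero, descentCurve_zero, saddlePlus_one_eq_refl]
  im_const s := by
    have := isSteepestDescentPath_descentCurve.im_const (-s)
    simp only [Complex.I_mul_im] at this ⊢
    rw [descentCurveRefl, saddlePlus_one_eq_refl, phasePlus_neg_conj, phasePlus_neg_conj]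
    simpa using this
  re_mono := by
    intro a ha b hb hab
    have := isSteepestDescentPath_descentCurve.re_anti (a := -b) (b := -a)
      (by simpa using hb) (by simpa using ha) (by linarith)
    simp only [descentCurveRefl, phasePlus_neg_conj]
    simpa using this
  re_anti := by
    intro a ha b hb hab
    have := isSteepestDescentPath_descentCurve.re_mono (a := -b) (b := -a)
      (by simpa using hb) (by simpa using ha) (by linarith)
    simp only [descentCurveRefl, phasePlus_neg_conj]
    simpa using this

/-! ### Asymptotic directions and size of the curve -/

lemma arg_of_re_pos {t : ℂ} (h : 0 < t.re) : t.arg = Real.arctan (t.im / t.re) := by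
  rw [← Complex.tan_arg, Real.arctan_tan]
  · exact (abs_lt.1 (Complex.abs_arg_lt_pi_div_two_iff.2 (Or.inl h))).1
  · exact (abs_lt.1 (Complex.abs_arg_lt_pi_div_two_iff.2 (Or.inl h))).2

lemma arg_neg_conj_of_re_pos_im_pos {t : ℂ} (hre : 0 < t.re) (him : 0 < t.im) :
    (-(starRingEnd ℂ) t).arg = Real.pi - t.arg := by
  have h0 : 0 < t.arg := Complex.arg_nonneg_iff.2 him.le |>.lt_of_ne' (by
    intro h; rw [Complex.arg_eq_zero_iff] at h; linarith [h.2])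
  have h1 : t.arg < Real.pi := Complex.arg_lt_pi_iff.2 (Or.inl hre.le)
  have hc : ((starRingEnd ℂ) t).arg = -t.arg := by
    rw [Complex.arg_conj, if_neg h1.ne]
  rw [Complex.arg_neg_eq_arg_add_pi_of_im_neg (by simpa using him), hc]; ring

/-- The slope of the right end of the curve, in the form in which the limit of v/u appears; it
follows from cos(π/5) = (1 + √5)/4 by halving the angle. -/
lemma tan_pi_div_ten : Real.tan (Real.pi / 10) = √(1 - 2 / √5) := by
  have h5 : √5 ^ 2 = 5 := Real.sq_sqrt (by norm_num)
  have hpos : 0 < √5 := by positivity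
  have hc : 0 < Real.cos (Real.pi / 10) :=
    Real.cos_pos_of_mem_Ioo ⟨by linarith [Real.pi_pos], by linarith [Real.pi_pos]⟩
  have ht : 0 ≤ Real.tan (Real.pi / 10) :=
    (Real.tan_pos_of_pos_of_lt_pi_div_two (by linarith [Real.pi_pos])
      (by linarith [Real.pi_pos])).le
  have h2 : Real.cos (Real.pi / 10) ^ 2 = (5 + √5) / 8 := by
    have := Real.cos_sq (Real.pi / 10)
    rw [show 2 * (Real.pi / 10) = Real.pi / 5 by ring, Real.cos_pi_div_five] at this
    rw [this]; ring
  have hs : Real.sin (Real.pi / 10) ^ 2 = (3 - √5) / 8 := by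
    rw [Real.sin_sq, h2]; ring
  symm
  rw [Real.sqrt_eq_iff_mul_self_eq_of_pos (by
    rw [Real.tan_eq_sin_div_cos]
    have : 0 < Real.sin (Real.pi / 10) :=
      Real.sin_pos_of_pos_of_lt_pi (by linarith [Real.pi_pos]) (by linarith [Real.pi_pos])
    positivity), ← sq, Real.tan_eq_sin_div_cos, div_pow, h2, hs]
  field_simp
  linear_combination (-2 : ℝ) * h5

lemma norm_sq_descentCurve (σ : ℝ) : ‖descentCurve σ‖ ^ 2 =
    Real.exp σ ^ 2 / 2 + descentSq (Real.exp σ) := by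
  rw [← Complex.normSq_eq_norm_sq, Complex.normSq_apply, descentCurve_re, descentCurve_im,
    Real.mul_self_sqrt (descentSq_pos (Real.exp_pos σ)).le, ← sq, div_pow,
    Real.sq_sqrt (by norm_num : (0 : ℝ) ≤ 2)]

/-- The exponent is set by the left end, where v² is of order s^{-1/2} = e^{|σ|/2}; on the right
|t|² grows faster. -/
lemma le_norm_sq_descentCurve (σ : ℝ) :
    Real.exp (|σ| / 2) / 8 ≤ ‖descentCurve σ‖ ^ 2 := by
  rw [norm_sq_descentCurve]
  rcases le_total 0 σ with h | h
  · have h1 : Real.exp (|σ| / 2) ≤ Real.exp σ := by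
      rw [abs_of_nonneg h]; exact Real.exp_le_exp.2 (by linarith)
    have h2 := descentSq_pos (Real.exp_pos σ)
    have h3 : 1 ≤ Real.exp σ := Real.one_le_exp h
    nlinarith
  · have hs := Real.exp_pos σ
    have h1 : Real.exp σ ≤ 1 := Real.exp_le_one_iff.2 h
    have hr := descentRad_pos hs
    have hr2 := sq_descentRad hs
    have hr1 := descentRad_lower_of_le_one hs h1
    have hx : Real.exp (|σ| / 2) ^ 2 * Real.exp σ = 1 := by
      rw [abs_of_nonpos h, ← Real.exp_nat_mul, ← Real.exp_add]; push_cast; ring_nf; exact Real.exp_zero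
    have hxp := Real.exp_pos (|σ| / 2)
    unfold descentSq
    set x := Real.exp (|σ| / 2)
    set s := Real.exp σ
    have hxe : 4 / s = 4 * x ^ 2 := by
      rw [div_eq_iff hs.ne']; linear_combination (-4 : ℝ) * hx
    rw [hxe] at hr2
    have hrx : x / 2 ≤ descentRad s := by
      apply le_of_sq_le_sq _ hr.le
      nlinarith
    -- For s ≤ 1/2 the term (1 - s)·`descentRad s` is at least x/4. For s ≥ 1/2 the number x is
    -- bounded and s² alone suffices.
    rcases le_total s (1 / 2) with h2 | h2
    · nlinarith
    · have : x ≤ 2 := by nlinarith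
      nlinarith [mul_nonneg (sub_nonneg.2 h1) hr.le]

lemma exp_le_norm_descentCurve (σ : ℝ) : Real.exp (|σ| / 4) / 3 ≤ ‖descentCurve σ‖ := by
  refine le_of_sq_le_sq ((le_trans ?_ (le_norm_sq_descentCurve σ))) (norm_nonneg _)
  have : Real.exp (|σ| / 2) = Real.exp (|σ| / 4) ^ 2 := by
    rw [← Real.exp_nat_mul]; congr 1; push_cast; ring
  rw [this, div_pow]
  nlinarith [sq_nonneg (Real.exp (|σ| / 4))]

lemma tendsto_exp_abs_cocompact (c : ℝ) (hc : 0 < c) :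
    Tendsto (fun σ : ℝ => Real.exp (|σ| * c)) (cocompact ℝ) atTop :=
  Real.tendsto_exp_atTop.comp ((tendsto_norm_cocompact_atTop (E := ℝ)).atTop_mul_const hc)

lemma tendsto_norm_descentCurve :
    Tendsto (fun σ => ‖descentCurve σ‖) (cocompact ℝ) atTop := by
  refine tendsto_atTop_mono exp_le_norm_descentCurve ?_
  exact (tendsto_exp_abs_cocompact (1 / 4) (by norm_num)).atTop_mul_const
    (by norm_num : (0 : ℝ) < 1 / 3) |>.congr fun σ => by ring_nf

lemma descentCurve_im_div_re (σ : ℝ) : (descentCurve σ).im / (descentCurve σ).re =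
    √(2 * descentSq (Real.exp σ) / Real.exp σ ^ 2) := by
  rw [descentCurve_re, descentCurve_im, Real.sqrt_div (by
    have := descentSq_pos (Real.exp_pos σ); positivity), Real.sqrt_mul (by norm_num),
    Real.sqrt_sq (Real.exp_pos σ).le]
  field_simp

lemma tendsto_im_div_re_atTop : Tendsto
    (fun σ => (descentCurve σ).im / (descentCurve σ).re) atTop (𝓝 (Real.tan (Real.pi / 10))) := by
  rw [tan_pi_div_ten]
  simp_rw [descentCurve_im_div_re]
  refine Tendsto.sqrt ?_
  have hx : Tendsto (fun σ : ℝ => Real.exp (-σ)) atTop (𝓝 0) :=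
    Real.tendsto_exp_neg_atTop_nhds_zero
  -- In the variable x = 1/s the ratio v²/u² extends continuously to x = 0, with value 1 - 2/√5.
  have h : Continuous fun x : ℝ =>
      1 - 2 * (1 - x) * √((1 + 2 * x + 3 * x ^ 2 + 4 * x ^ 3) / 5) := by fun_prop
  have h2 := (h.tendsto 0).comp hx
  have e : (1 : ℝ) - 2 * (1 - 0) * √((1 + 2 * 0 + 3 * 0 ^ 2 + 4 * 0 ^ 3) / 5) = 1 - 2 / √5 := by
    norm_num; rfl
  rw [e] at h2
  refine h2.congr fun σ => ?_
  have hs := Real.exp_pos σ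
  simp only [Function.comp, Real.exp_neg, descentSq]
  have : descentRad (Real.exp σ) = Real.exp σ * √((1 + 2 * (Real.exp σ)⁻¹ +
      3 * (Real.exp σ)⁻¹ ^ 2 + 4 * (Real.exp σ)⁻¹ ^ 3) / 5) := by
    rw [descentRad, show (Real.exp σ ^ 2 + 2 * Real.exp σ + 3 + 4 / Real.exp σ) / 5 =
      Real.exp σ ^ 2 * ((1 + 2 * (Real.exp σ)⁻¹ + 3 * (Real.exp σ)⁻¹ ^ 2 +
        4 * (Real.exp σ)⁻¹ ^ 3) / 5) by field_simp, Real.sqrt_mul (sq_nonneg _),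
      Real.sqrt_sq hs.le]
  rw [this]
  field_simp

lemma tendsto_im_div_re_atBot : Tendsto
    (fun σ => (descentCurve σ).im / (descentCurve σ).re) atBot atTop := by
  have h : Tendsto (fun σ : ℝ => Real.exp (-σ) / 2) atBot atTop :=
    (Real.tendsto_exp_atTop.comp tendsto_neg_atBot_atTop).atTop_div_const (by norm_num)
  refine tendsto_atTop_mono' _ ?_ h
  filter_upwards [eventually_le_atBot 0] with σ hσ
  rw [descentCurve_im_div_re]
  apply Real.le_sqrt_of_sq_le
  have h1 := descentSq_lower_of_le_one (Real.exp_pos σ) (Real.exp_le_one_iff.2 hσ)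
  rw [Real.exp_neg, le_div_iff₀ (by positivity)]
  have := Real.exp_pos σ
  field_simp
  linarith

lemma tendsToInftyDir_descentCurve_atTop :
    TendsToInftyDir descentCurve atTop (Real.pi / 10) := by
  refine ⟨tendsto_norm_descentCurve.mono_left atTop_le_cocompact, ?_⟩
  have h := (Real.continuous_arctan.tendsto _).comp tendsto_im_div_re_atTop
  rw [Real.arctan_tan (by linarith [Real.pi_pos]) (by linarith [Real.pi_pos])] at h
  exact h.congr fun σ => (arg_of_re_pos (descentCurve_re_pos σ)).symm

lemma tendsToInftyDir_descentCurve_atBot :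
    TendsToInftyDir descentCurve atBot (Real.pi / 2) := by
  refine ⟨tendsto_norm_descentCurve.mono_left atBot_le_cocompact, ?_⟩
  have h := (Real.tendsto_arctan_atTop.mono_right nhdsWithin_le_nhds).comp tendsto_im_div_re_atBot
  exact h.congr fun σ => (arg_of_re_pos (descentCurve_re_pos σ)).symm

lemma TendsToInftyDir.refl {l l' : Filter ℝ} {α : ℝ} (h : TendsToInftyDir descentCurve l α)
    (hl : Tendsto (fun σ : ℝ => -σ) l' l) :
    TendsToInftyDir descentCurveRefl l' (Real.pi - α) := by
  refine ⟨(h.1.comp hl).congr fun σ => by simp [descentCurveRefl], ?_⟩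
  exact ((h.2.comp hl).const_sub Real.pi).congr fun σ =>
    (arg_neg_conj_of_re_pos_im_pos (descentCurve_re_pos _) (descentCurve_im_pos _)).symm

lemma tendsToInftyDir_descentCurveRefl_atBot :
    TendsToInftyDir descentCurveRefl atBot (9 * Real.pi / 10) := by
  convert tendsToInftyDir_descentCurve_atTop.refl tendsto_neg_atBot_atTop using 1; ring

lemma tendsToInftyDir_descentCurveRefl_atTop :
    TendsToInftyDir descentCurveRefl atTop (Real.pi / 2) := by
  convert tendsToInftyDir_descentCurve_atBot.refl tendsto_neg_atTop_atBot using 1; ring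

lemma norm_descentVel_le (σ : ℝ) : ‖descentVel σ‖ ≤ 40 * Real.exp (3 * |σ|) := by
  have hs := Real.exp_pos σ
  have hs2 := descentSq_lower hs
  have hv : 1 / 7 ≤ √(descentSq (Real.exp σ)) := by
    apply Real.le_sqrt_of_sq_le; linarith
  have hx : Real.exp (3 * |σ|) = Real.exp |σ| ^ 3 := by
    rw [← Real.exp_nat_mul]; push_cast; ring_nf
  have hsx : Real.exp σ ≤ Real.exp |σ| := Real.exp_le_exp.2 (le_abs_self σ)
  have hix : (Real.exp σ)⁻¹ ≤ Real.exp |σ| := by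
    rw [← Real.exp_neg]; exact Real.exp_le_exp.2 (neg_le_abs σ)
  have hx1 : 1 ≤ Real.exp |σ| := Real.one_le_exp (abs_nonneg σ)
  have hr := descentRad_pos hs
  have hr2 := sq_descentRad hs
  have hd : |descentSqDeriv (Real.exp σ) * Real.exp σ| ≤ 6 * Real.exp |σ| ^ 3 := by
    unfold descentSqDeriv
    set s := Real.exp σ
    set x := Real.exp |σ|
    have hrx : descentRad s ≤ 3 / 2 * x := by
      apply le_of_sq_le_sq _ (by positivity)
      rw [hr2, show 4 / s = 4 * s⁻¹ by ring]
      nlinarith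
    -- The derivative of the radicand times s is bounded by twice the radicand, term by term, so s
    -- times the derivative of the root is bounded by the root.
    have ht : |s * ((2 * s + 2 - 4 / s ^ 2) / 5 / (2 * descentRad s))| ≤ descentRad s := by
      have : s * ((2 * s + 2 - 4 / s ^ 2) / 5 / (2 * descentRad s)) =
        (2 * s ^ 2 + 2 * s - 4 / s) / 5 / (2 * descentRad s) := by field_simp
      rw [this, abs_div, abs_of_pos (by positivity : 0 < 2 * descentRad s),
        div_le_iff₀ (by positivity)]
      have : descentRad s * (2 * descentRad s) = 2 * descentRad s ^ 2 := by ring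
      have h4 : 0 < 4 / s := by positivity
      rw [this, hr2, abs_le]
      constructor <;> nlinarith
    have e : (s - descentRad s - (s - 1) * ((2 * s + 2 - 4 / s ^ 2) / 5 / (2 * descentRad s))) * s
      = s ^ 2 - s * descentRad s -
        (s - 1) * (s * ((2 * s + 2 - 4 / s ^ 2) / 5 / (2 * descentRad s))) := by ring
    rw [e]
    set y := s * ((2 * s + 2 - 4 / s ^ 2) / 5 / (2 * descentRad s))
    have hy : |(s - 1) * y| ≤ x * (3 / 2 * x) := by
      rw [abs_mul]
      refine mul_le_mul ?_ (ht.trans hrx) (abs_nonneg _) (by positivity)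
      rw [abs_le]; constructor <;> linarith
    have h2 : s ^ 2 ≤ x ^ 2 := by gcongr
    have h3 : s * descentRad s ≤ x * (3 / 2 * x) := by gcongr
    have h4 : 0 ≤ s * descentRad s := by positivity
    have h5 : x ^ 2 ≤ x ^ 3 := pow_le_pow_right₀ hx1 (by norm_num)
    rw [abs_le] at hy ⊢
    constructor <;> nlinarith [hy.1, hy.2, sq_nonneg s]
  refine (Complex.norm_le_abs_re_add_abs_im _).trans ?_
  rw [descentVel_re, descentVel_im, abs_of_pos (by positivity : 0 < Real.exp σ / √2), abs_div,
    abs_of_pos (by positivity : 0 < 2 * √(descentSq (Real.exp σ))), hx]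
  have h1 : Real.exp σ / √2 ≤ Real.exp |σ| ^ 3 := by
    have : Real.exp σ / √2 ≤ Real.exp σ :=
      div_le_self hs.le (Real.one_le_sqrt.2 (by norm_num))
    have h3 : Real.exp |σ| ≤ Real.exp |σ| ^ 3 := le_self_pow₀ hx1 (by norm_num)
    linarith
  have h2 : |descentSqDeriv (Real.exp σ) * Real.exp σ| / (2 * √(descentSq (Real.exp σ))) ≤
      21 * Real.exp |σ| ^ 3 := by
    rw [div_le_iff₀ (by positivity)]
    have : 0 < Real.exp |σ| ^ 3 := by positivity
    nlinarith
  have : 0 < Real.exp |σ| ^ 3 := by positivity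
  linarith

/-! ### Height along the curve and integrability -/

/-- The drop of `Re (i f₊)` along the steepest descent curve, measured from the saddle. -/
noncomputable def descentHeight (σ : ℝ) : ℝ :=
  (phasePlus (descentCurve σ)).im - 4 / (5 * √2)

lemma phasePlus_saddlePlus_zero : phasePlus (saddlePlus 0) =
    ((4 / (5 * √2) : ℝ) : ℂ) * (1 + Complex.I) := by
  have h : phasePlus (saddlePlus 0) = 4 / 5 * saddlePlus 0 := by
    rw [phasePlus]; linear_combination (saddlePlus 0 / 5) * saddlePlus_zero_pow_four
  rw [h, saddlePlus_zero_eq]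
  push_cast
  have : (√2 : ℂ) ≠ 0 := by simp
  field_simp

lemma phasePlus_descentCurve (σ : ℝ) : phasePlus (descentCurve σ) =
    phasePlus (saddlePlus 0) + descentHeight σ * Complex.I := by
  have h := phasePlus_descentCurve_re σ
  rw [phasePlus_saddlePlus_zero, descentHeight]
  generalize 4 / (5 * √2) = c at *
  apply Complex.ext
  · rw [h]; simp
  · simp

lemma descentHeight_zero : descentHeight 0 = 0 := by
  have h := phasePlus_descentCurve 0
  rw [descentCurve_zero] at h
  simpa using h

lemma descentHeight_pos {σ : ℝ} (h : σ ≠ 0) : 0 < descentHeight σ := by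
  have h0 := descentHeight_zero
  rcases h.lt_or_gt with h | h
  · have := isSteepestDescentPath_descentCurve.re_mono (mem_Iic.2 h.le) (mem_Iic.2 le_rfl) h
    simp only [Complex.I_mul_re] at this
    unfold descentHeight at *; linarith
  · have := isSteepestDescentPath_descentCurve.re_anti (mem_Ici.2 le_rfl) (mem_Ici.2 h.le) h
    simp only [Complex.I_mul_re] at this
    unfold descentHeight at *; linarith

lemma descentHeight_nonneg (σ : ℝ) : 0 ≤ descentHeight σ := by
  rcases eq_or_ne σ 0 with rfl | h
  · exact descentHeight_zero.ge
  · exact (descentHeight_pos h).le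

lemma descentHeight_eq_norm (σ : ℝ) :
    descentHeight σ = ‖phasePlus (descentCurve σ) - phasePlus (saddlePlus 0)‖ := by
  rw [phasePlus_descentCurve]
  simp [abs_of_nonneg (descentHeight_nonneg σ)]

lemma continuous_descentHeight : Continuous descentHeight :=
  (continuous_iff_continuousAt.2 fun σ =>
    (hasDerivAt_phasePlus_descentCurve_im σ).continuousAt).sub continuous_const

/-- The cubic cofactor of `(t - t₀)²` in `5 (f₊(t) - f₊(t₀))`. -/
noncomputable def saddleCofactor (t : ℂ) : ℂ :=
  t ^ 3 + 2 * saddlePlus 0 * t ^ 2 + 3 * saddlePlus 0 ^ 2 * t + 4 * saddlePlus 0 ^ 3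

lemma descentHeight_eq_mul (σ : ℝ) : descentHeight σ =
    ‖descentCurve σ - saddlePlus 0‖ ^ 2 * ‖saddleCofactor (descentCurve σ)‖ / 5 := by
  have : phasePlus (descentCurve σ) - phasePlus (saddlePlus 0) =
      (descentCurve σ - saddlePlus 0) ^ 2 * saddleCofactor (descentCurve σ) / 5 := by
    rw [phasePlus, phasePlus, saddleCofactor]
    linear_combination (descentCurve σ - saddlePlus 0) * saddlePlus_zero_pow_four
  rw [descentHeight_eq_norm, this]
  simp

lemma norm_saddlePlus_zero : ‖saddlePlus 0‖ = 1 := by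
  have h : ‖saddlePlus 0‖ ^ 4 = 1 := by rw [← norm_pow, saddlePlus_zero_pow_four]; simp
  exact (pow_eq_one_iff_of_nonneg (norm_nonneg _) (by norm_num)).1 h

/-- Since f - f(t_0) is a nonnegative multiple of i on the curve, the height equals its modulus, and
the triangle inequality compares it with |t|⁵/5. -/
lemma norm_pow_five_le_descentHeight (σ : ℝ) :
    ‖descentCurve σ‖ ^ 5 / 10 - 2 ≤ descentHeight σ := by
  rw [descentHeight_eq_norm]
  have h1 : phasePlus (saddlePlus 0) = 4 / 5 * saddlePlus 0 := by
    rw [phasePlus]; linear_combination (saddlePlus 0 / 5) * saddlePlus_zero_pow_four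
  have h3 : ‖phasePlus (saddlePlus 0)‖ = 4 / 5 := by rw [h1, norm_mul, norm_saddlePlus_zero]; norm_num
  set t := descentCurve σ
  have h4 : ‖t ^ 5 / 5‖ = ‖t‖ ^ 5 / 5 := by simp
  have h5 : ‖t ^ 5 / 5‖ ≤ ‖phasePlus t - phasePlus (saddlePlus 0)‖ + ‖t‖ + 4 / 5 := by
    have e : t ^ 5 / 5 = (phasePlus t - phasePlus (saddlePlus 0)) - t + phasePlus (saddlePlus 0) := by
      rw [phasePlus]; ring
    rw [e, ← h3]
    exact (norm_add_le _ _).trans (add_le_add_left (norm_sub_le _ _) _)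
  rw [h4] at h5
  have hx := norm_nonneg t
  have h6 : ‖t‖ ≤ ‖t‖ ^ 5 / 10 + 6 / 5 := by
    set x := ‖t‖
    nlinarith [sq_nonneg (x ^ 2 - 3 / 2), sq_nonneg (x - 6 / 5), mul_nonneg hx (sq_nonneg (x ^ 2 - 7 / 5)), sq_nonneg (x-1), mul_nonneg hx (sq_nonneg (x - 6 / 5))]
  linarith

lemma exists_pow_mul_exp_le (N : ℕ) (a c : ℝ) (ha : 0 < a) (hc : 0 ≤ c) :
    ∃ C, ∀ x : ℝ, 0 ≤ x → x ^ N * Real.exp (c * x - a * x ^ 5) ≤ C := by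
  -- Beyond X one has a x⁴ ≥ c + 1, so the exponent is at most -x; below X it is bounded.
  set X := 1 + (c + 1) / a with hX
  have hX1 : 1 ≤ X := by rw [hX]; linarith [div_nonneg (by linarith : 0 ≤ c + 1) ha.le]
  refine ⟨N.factorial * Real.exp ((c + 1) * X), fun x hx => ?_⟩
  have h1 : c * x - a * x ^ 5 ≤ (c + 1) * X - x := by
    have h5 : 0 ≤ a * x ^ 5 := by positivity
    rcases le_total x X with h | h
    · nlinarith
    · have hx1 : 1 ≤ x := hX1.trans h
      have h4 : (c + 1) ≤ a * x ^ 4 := by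
        have : (c + 1) / a ≤ x ^ 4 := by
          have : x ≤ x ^ 4 := le_self_pow₀ hx1 (by norm_num)
          linarith
        rw [div_le_iff₀ ha] at this; linarith
      have : 0 ≤ (c + 1) * X := by positivity
      nlinarith
  have h2 : x ^ N ≤ N.factorial * Real.exp x := by
    have := Real.pow_div_factorial_le_exp x hx N
    rwa [div_le_iff₀ (by positivity), mul_comm] at this
  calc x ^ N * Real.exp (c * x - a * x ^ 5)
      ≤ (N.factorial * Real.exp x) * Real.exp ((c + 1) * X - x) := by gcongr
    _ = N.factorial * Real.exp ((c + 1) * X) := by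
      rw [mul_assoc, ← Real.exp_add]; congr 2; ring

lemma integrable_exp_neg_abs : MeasureTheory.Integrable (fun σ : ℝ => Real.exp (-|σ|)) := by
  refine (integrable_inv_one_add_sq.const_mul 2).mono' (by fun_prop) (MeasureTheory.ae_of_all _ fun σ => ?_)
  rw [Real.norm_of_nonneg (Real.exp_pos _).le, Real.exp_neg, ← div_eq_mul_inv,
    ← one_div, div_le_div_iff₀ (Real.exp_pos _) (by positivity)]
  have := Real.quadratic_le_exp_of_nonneg (abs_nonneg σ)
  rw [sq_abs] at this
  linarith [abs_nonneg σ]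

/-- One majorant for all later needs: N = 0 gives integrability along the curve, N = 1
differentiation in the parameter. -/
lemma exists_descent_bound (N : ℕ) (A b : ℝ) (hA : 0 < A) (hb : 0 ≤ b) :
    ∃ C, ∀ σ, ‖descentCurve σ‖ ^ N * (Real.exp (A * (2 + ‖descentCurve σ‖ - ‖descentCurve σ‖ ^ 5 / 10)
      + b * ‖descentCurve σ‖) * ‖descentVel σ‖) ≤ C * Real.exp (-|σ|) := by
  -- Sixteen extra powers of |t| ≥ e^{|σ|/4}/3 absorb the velocity bound e^{3|σ|} and leave
  -- e^{-|σ|}.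
  obtain ⟨C, hC⟩ := exists_pow_mul_exp_le (N + 16) (A / 10) (A + b) (by positivity) (by positivity)
  refine ⟨40 * 3 ^ 16 * Real.exp (2 * A) * C, fun σ => ?_⟩
  have hx := norm_nonneg (descentCurve σ)
  have h1 := exp_le_norm_descentCurve σ
  have h2 := norm_descentVel_le σ
  have h3 := hC _ hx
  set x := ‖descentCurve σ‖
  have h4 : Real.exp (3 * |σ|) ≤ (3 * x) ^ 16 * Real.exp (-|σ|) := by
    have : Real.exp (3 * |σ|) = Real.exp (|σ| / 4) ^ 16 * Real.exp (-|σ|) := by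
      rw [← Real.exp_nat_mul, ← Real.exp_add]; congr 1; push_cast; ring
    rw [this]
    gcongr
    linarith
  have h5 : Real.exp (A * (2 + x - x ^ 5 / 10) + b * x) =
      Real.exp (2 * A) * Real.exp ((A + b) * x - A / 10 * x ^ 5) := by
    rw [← Real.exp_add]; congr 1; ring
  rw [h5]
  calc _ ≤ x ^ N * (Real.exp (2 * A) * Real.exp ((A + b) * x - A / 10 * x ^ 5) *
        (40 * ((3 * x) ^ 16 * Real.exp (-|σ|)))) := by gcongr; linarith
    _ = 40 * 3 ^ 16 * Real.exp (2 * A) *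
        (x ^ (N + 16) * Real.exp ((A + b) * x - A / 10 * x ^ 5)) * Real.exp (-|σ|) := by ring
    _ ≤ _ := by gcongr

/-- The integrand `exp(i (A t⁵/5 + B t))`. -/
noncomputable def quinticExp (A : ℝ) (B t : ℂ) : ℂ :=
  Complex.exp (Complex.I * (A * t ^ 5 / 5 + B * t))

/-- The exponent is split as A f(t) - At + Bt: the first term decays by the height bound, the others
grow only linearly. B may be complex, as analyticity in z requires. -/
lemma norm_quinticExp_descentCurve_le {A : ℝ} (hA : 0 < A) (B : ℂ) (σ : ℝ) :
    ‖quinticExp A B (descentCurve σ)‖ ≤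
      Real.exp (A * (2 + ‖descentCurve σ‖ - ‖descentCurve σ‖ ^ 5 / 10) +
        ‖B‖ * ‖descentCurve σ‖) := by
  rw [quinticExp, Complex.norm_exp]
  apply Real.exp_le_exp.2
  have h1 := norm_pow_five_le_descentHeight σ
  set t := descentCurve σ with ht
  have e : Complex.I * (A * t ^ 5 / 5 + B * t) =
      Complex.I * ((A : ℂ) * phasePlus t) - Complex.I * ((A : ℂ) * t) + Complex.I * (B * t) := by
    rw [phasePlus]; ring
  rw [e]
  simp only [Complex.add_re, Complex.sub_re, Complex.I_mul_re, Complex.im_ofReal_mul]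
  have h2 : (phasePlus t).im = descentHeight σ + 4 / (5 * √2) := by rw [descentHeight]; ring
  have h3 : t.im ≤ ‖t‖ := Complex.im_le_norm t
  have h4 : -(B * t).im ≤ ‖B‖ * ‖t‖ := by
    rw [← norm_mul]; exact (neg_le_abs _).trans (Complex.abs_im_le_norm _)
  have h5 : 0 < 4 / (5 * √2) := by positivity
  have h6 : -(phasePlus t).im + t.im ≤ 2 + ‖t‖ - ‖t‖ ^ 5 / 10 := by rw [h2]; linarith
  nlinarith

lemma continuous_quinticExp (A : ℝ) (B : ℂ) : Continuous (quinticExp A B) := by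
  unfold quinticExp; fun_prop

lemma integrable_quinticExp_descentCurve {A : ℝ} (hA : 0 < A) (B : ℂ) :
    MeasureTheory.Integrable (fun σ => quinticExp A B (descentCurve σ) * descentVel σ) := by
  obtain ⟨C, hC⟩ := exists_descent_bound 0 A ‖B‖ hA (norm_nonneg _)
  refine (integrable_exp_neg_abs.const_mul C).mono'
    (((continuous_quinticExp A B).comp continuous_descentCurve).mul
      continuous_descentVel).aestronglyMeasurable (MeasureTheory.ae_of_all _ fun σ => ?_)
  refine le_trans ?_ (hC σ)
  rw [norm_mul, pow_zero, one_mul]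
  gcongr
  exact norm_quinticExp_descentCurve_le hA B σ

lemma pathIntegrand_descentCurve (lam : ℝ) : pathIntegrand descentCurve lam =
    fun σ => quinticExp lam lam (descentCurve σ) * descentVel σ := by
  funext σ
  rw [pathIntegrand, deriv_descentCurve, quinticExp, phasePlus]
  congr 2; ring

lemma pathIntegrand_descentCurveRefl (lam σ : ℝ) : pathIntegrand descentCurveRefl lam σ =
    (starRingEnd ℂ) (pathIntegrand descentCurve lam (-σ)) := by
  rw [pathIntegrand, pathIntegrand, deriv_descentCurve, (hasDerivAt_descentCurveRefl σ).deriv,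
    map_mul, ← Complex.exp_conj, descentCurveRefl, phasePlus_neg_conj]
  simp

lemma integrable_pathIntegrand_descentCurve {lam : ℝ} (h : 0 < lam) :
    MeasureTheory.Integrable (pathIntegrand descentCurve lam) := by
  rw [pathIntegrand_descentCurve]; exact integrable_quinticExp_descentCurve h _

lemma integrable_pathIntegrand_descentCurveRefl {lam : ℝ} (h : 0 < lam) :
    MeasureTheory.Integrable (pathIntegrand descentCurveRefl lam) := by
  have h1 := (integrable_pathIntegrand_descentCurve h).comp_neg
  have h2 := Complex.conjCLE.toContinuousLinearMap.integrable_comp h1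
  exact h2.congr (MeasureTheory.ae_of_all _ fun σ => (pathIntegrand_descentCurveRefl lam σ).symm)

lemma pathIntegral_descentCurveRefl (lam : ℝ) : pathIntegral descentCurveRefl lam =
    (starRingEnd ℂ) (pathIntegral descentCurve lam) := by
  rw [pathIntegral, pathIntegral, ← integral_conj]
  simp_rw [pathIntegrand_descentCurveRefl]
  exact MeasureTheory.integral_neg_eq_self
    (fun σ => (starRingEnd ℂ) (pathIntegrand descentCurve lam σ)) _

/-! ### Deformation of the contour -/

lemma norm_quinticExp (A B x y : ℝ) : ‖quinticExp A B (x + y * Complex.I)‖ =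
    Real.exp (-(A * (x ^ 4 * y - 2 * x ^ 2 * y ^ 3 + y ^ 5 / 5) + B * y)) := by
  rw [quinticExp, Complex.norm_exp]
  congr 1
  have e : Complex.I * (A * ((x : ℂ) + y * Complex.I) ^ 5 / 5 + B * (x + y * Complex.I)) =
      Complex.I * ((A : ℂ) * phasePlus (x + y * Complex.I)) +
        Complex.I * (((B - A : ℝ) : ℂ) * (x + y * Complex.I)) := by
    rw [phasePlus]; push_cast; ring
  rw [e]
  simp only [Complex.add_re, Complex.I_mul_re, Complex.im_ofReal_mul, phasePlus_im,
    Complex.add_im, Complex.re_ofReal_mul, Complex.ofReal_re, Complex.ofReal_im, Complex.I_re,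
    Complex.I_im]
  ring

/-- A primitive of `quinticExp A B` vanishing at the origin exists. -/
lemma exists_primitive_quinticExp (A : ℝ) (B : ℂ) :
    ∃ G : ℂ → ℂ, G 0 = 0 ∧ ∀ t, HasDerivAt G (quinticExp A B t) t := by
  have h : Differentiable ℂ (quinticExp A B) := by unfold quinticExp; fun_prop
  obtain ⟨G, h0, hG⟩ := h.isExactOn_univ.with_val_at 0 0
  exact ⟨G, h0, fun t => hG t (mem_univ t)⟩

section
variable {A B : ℝ} {G : ℂ → ℂ} (hG : ∀ t, HasDerivAt G (quinticExp A B t) t)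
include hG

lemma hasDerivAt_primitive_horizontal (x y : ℝ) :
    HasDerivAt (fun x : ℝ => G (x + y * Complex.I)) (quinticExp A B (x + y * Complex.I)) x := by
  have h : HasDerivAt (fun x : ℝ => (x : ℂ) + y * Complex.I) 1 x :=
    Complex.ofRealCLM.hasDerivAt.add_const _
  have h2 := (hG (x + y * Complex.I)).comp x h
  rw [mul_one] at h2
  exact h2

lemma hasDerivAt_primitive_vertical (x y : ℝ) :
    HasDerivAt (fun y : ℝ => G (x + y * Complex.I))
      (quinticExp A B (x + y * Complex.I) * Complex.I) y := by
  have h : HasDerivAt (fun y : ℝ => (x : ℂ) + y * Complex.I) Complex.I y := by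
    simpa using (Complex.ofRealCLM.hasDerivAt (x := y)).mul_const Complex.I |>.const_add (x : ℂ)
  exact (hG (x + y * Complex.I)).comp y h

lemma hasDerivAt_primitive_real (x : ℝ) :
    HasDerivAt (fun x : ℝ => G x) (quinticExp A B x) x := by
  simpa using hasDerivAt_primitive_horizontal hG x 0

lemma integral_quinticExp_real (a b : ℝ) :
    ∫ x in a..b, quinticExp A B x = G b - G a :=
  intervalIntegral.integral_eq_sub_of_hasDerivAt (fun x _ => hasDerivAt_primitive_real hG x)
    (((continuous_quinticExp A B).comp Complex.continuous_ofReal).intervalIntegrable _ _)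

/-- In the wedge 0 ≤ y ≤ x/2 the integrand is at most e^{-ky} with k = Ax⁴/2, so the vertical
integral is below 1/k. -/
lemma norm_primitive_vertical_le (hA : 0 < A) (hB : 0 ≤ B) {x y : ℝ} (hx : 0 < x) (hy : 0 ≤ y)
    (hxy : y ≤ x / 2) : ‖G (x + y * Complex.I) - G x‖ ≤ 2 / (A * x ^ 4) := by
  set k := A * x ^ 4 / 2 with hk
  have hk0 : 0 < k := by positivity
  have key := image_norm_le_of_norm_deriv_right_le_deriv_boundary
    (f := fun y : ℝ => G (x + y * Complex.I) - G x)
    (f' := fun y : ℝ => quinticExp A B (x + y * Complex.I) * Complex.I) (a := 0) (b := y)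
    (B := fun y => (1 - Real.exp (-(k * y))) / k) (B' := fun y => Real.exp (-(k * y)))
    (fun y _ => ((hasDerivAt_primitive_vertical hG x y).sub_const _).continuousAt.continuousWithinAt)
    (fun y _ => ((hasDerivAt_primitive_vertical hG x y).sub_const _).hasDerivWithinAt)
    (by simp) ?_ ?_ (right_mem_Icc.2 hy)
  · refine key.trans ?_
    have : 2 / (A * x ^ 4) = 1 / k := by rw [hk]; field_simp
    rw [this]
    gcongr
    linarith [Real.exp_pos (-(k * y))]
  · intro y
    have := (((((hasDerivAt_id y).const_mul k).fun_neg).exp).const_sub 1).div_const k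
    refine this.congr_deriv ?_
    simp only [id]
    field_simp
  · rintro t ⟨ht0, ht⟩
    rw [norm_mul, Complex.norm_I, mul_one, norm_quinticExp]
    apply Real.exp_le_exp.2
    have h1 : t ^ 2 ≤ x ^ 2 / 4 := by nlinarith
    have h2 : x ^ 4 * t / 2 ≤ x ^ 4 * t - 2 * x ^ 2 * t ^ 3 + t ^ 5 / 5 := by
      have : 0 ≤ t ^ 5 := by positivity
      have h3 : 0 ≤ (x ^ 2 / 4 - t ^ 2) * (x ^ 2 * t) :=
        mul_nonneg (by linarith) (by positivity)
      nlinarith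
    have h4 := mul_le_mul_of_nonneg_left h2 hA.le
    have h5 : 0 ≤ B * t := by positivity
    rw [hk]; linarith

/-- Close to the imaginary axis the y⁵ term dominates and the integrand has modulus at most 1; the
bound is the length of the segment. -/
lemma norm_primitive_horizontal_le (hA : 0 < A) (hB : 0 ≤ B) {x y : ℝ} (hx : 0 ≤ x)
    (hxy : 4 * x ≤ y) : ‖G (x + y * Complex.I) - G (y * Complex.I)‖ ≤ x := by
  have := (convex_Icc (0 : ℝ) x).norm_image_sub_le_of_norm_hasDerivWithin_le
    (f := fun x : ℝ => G (x + y * Complex.I)) (C := 1)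
    (fun t _ => (hasDerivAt_primitive_horizontal hG t y).hasDerivWithinAt) ?_
    (left_mem_Icc.2 hx) (right_mem_Icc.2 hx)
  · simpa [abs_of_nonneg hx] using this
  · rintro t ⟨ht0, ht⟩
    rw [norm_quinticExp]
    apply Real.exp_le_one_iff.2
    have hy : 0 ≤ y := by linarith
    have h1 : t ^ 2 ≤ y ^ 2 / 16 := by nlinarith
    have h2 : 0 ≤ t ^ 4 * y - 2 * t ^ 2 * y ^ 3 + y ^ 5 / 5 := by
      have : 0 ≤ t ^ 4 * y := by positivity
      have h3 : 0 ≤ (y ^ 2 / 16 - t ^ 2) * y ^ 3 :=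
        mul_nonneg (by linarith) (by positivity)
      have h4 : 0 ≤ y ^ 5 := by positivity
      nlinarith
    have := mul_nonneg hA.le h2
    have := mul_nonneg hB hy
    linarith

/-- On the imaginary axis the integrand is real while dt = i dy. -/
lemma primitive_imaginary_axis_re (h0 : G 0 = 0) (y : ℝ) : (G (y * Complex.I)).re = 0 := by
  have hd : ∀ y : ℝ, HasDerivAt (fun y : ℝ => (G (y * Complex.I)).re) 0 y := by
    intro y
    have h := hasDerivAt_primitive_vertical hG 0 y
    simp only [Complex.ofReal_zero, zero_add] at h
    have := Complex.reCLM.hasFDerivAt.comp_hasDerivAt y h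
    refine this.congr_deriv ?_
    have e : quinticExp A B (y * Complex.I) = ((Real.exp (-(A * y ^ 5 / 5 + B * y)) : ℝ) : ℂ) := by
      rw [quinticExp, Complex.ofReal_exp]
      congr 1
      push_cast
      linear_combination (A * y ^ 5 / 5 * (Complex.I ^ 4 - Complex.I ^ 2 + 1) + B * y : ℂ)
        * Complex.I_sq
    rw [e]
    simp [-Complex.ofReal_exp]
  have := is_const_of_deriv_eq_zero (fun y => (hd y).differentiableAt) (fun y => (hd y).deriv) y 0
  simpa [h0] using this

lemma primitive_neg_real (h0 : G 0 = 0) (x : ℝ) :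
    G ((-x : ℝ) : ℂ) = -(starRingEnd ℂ) (G x) := by
  have hd : ∀ x : ℝ, HasDerivAt (fun x : ℝ => G ((-x : ℝ) : ℂ) + (starRingEnd ℂ) (G x)) 0 x := by
    intro x
    have h1 := (hasDerivAt_primitive_real hG (-x)).scomp x (hasDerivAt_neg x)
    have h2 := Complex.conjCLE.toContinuousLinearMap.hasFDerivAt.comp_hasDerivAt x
      (hasDerivAt_primitive_real hG x)
    refine (h1.add h2).congr_deriv ?_
    have : (starRingEnd ℂ) (quinticExp A B x) = quinticExp A B ((-x : ℝ) : ℂ) := by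
      rw [quinticExp, quinticExp, ← Complex.exp_conj]
      congr 1
      simp only [map_mul, map_add, map_div₀, map_pow, Complex.conj_I, Complex.conj_ofReal,
        map_ofNat, Complex.ofReal_neg]
      ring
    rw [← this]
    simp
  have := is_const_of_deriv_eq_zero (fun y => (hd y).differentiableAt) (fun y => (hd y).deriv) x 0
  simp only [neg_zero, Complex.ofReal_zero, h0, map_zero, add_zero] at this
  exact eq_neg_of_add_eq_zero_left this

lemma hasDerivAt_primitive_descentCurve (σ : ℝ) : HasDerivAt (fun σ => G (descentCurve σ))
    (quinticExp A B (descentCurve σ) * descentVel σ) σ :=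
  (hG _).comp σ (hasDerivAt_descentCurve σ)

lemma tendsto_primitive_sub_atTop (hA : 0 < A) (hB : 0 ≤ B) :
    Tendsto (fun σ : ℝ => G (descentCurve σ) - G ((Real.exp σ / √2 : ℝ) : ℂ)) atTop (𝓝 0) := by
  have hlim : Tendsto (fun σ : ℝ => 2 / (A * (Real.exp σ / √2) ^ 4)) atTop (𝓝 0) := by
    refine tendsto_const_nhds.div_atTop ?_
    refine Tendsto.const_mul_atTop hA ?_
    exact (tendsto_pow_atTop (by norm_num)).comp
      (Real.tendsto_exp_atTop.atTop_div_const (by positivity))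
  refine squeeze_zero_norm' ?_ hlim
  -- Hence the right end of the curve lies in the wedge where the vertical estimate applies.
  have h2 : Real.tan (Real.pi / 10) < 1 / 2 := by
    rw [tan_pi_div_ten, Real.sqrt_lt' (by norm_num)]
    have h5 : √5 < 8 / 3 := by rw [Real.sqrt_lt' (by norm_num)]; norm_num
    have : 3 / 4 < 2 / √5 := by
      rw [div_lt_div_iff₀ (by norm_num) (by positivity)]; linarith
    linarith
  filter_upwards [tendsto_im_div_re_atTop.eventually_lt_const h2] with σ hσ
  have hre := descentCurve_re_pos σ
  have := norm_primitive_vertical_le hG hA hB hre (descentCurve_im_pos σ).le (by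
    rw [div_lt_iff₀ hre] at hσ; linarith)
  rwa [Complex.re_add_im, descentCurve_re] at this

lemma tendsto_primitive_re_atBot (h0 : G 0 = 0) (hA : 0 < A) (hB : 0 ≤ B) :
    Tendsto (fun σ : ℝ => (G (descentCurve σ)).re) atBot (𝓝 0) := by
  have hlim : Tendsto (fun σ : ℝ => Real.exp σ / √2) atBot (𝓝 0) := by
    simpa using Real.tendsto_exp_atBot.div_const √2
  refine squeeze_zero_norm' ?_ hlim
  filter_upwards [tendsto_im_div_re_atBot.eventually_ge_atTop 4] with σ hσ
  have hre := descentCurve_re_pos σ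
  have := norm_primitive_horizontal_le hG hA hB hre.le ((le_div_iff₀ hre).1 hσ)
  rw [Complex.re_add_im] at this
  have h := (Complex.abs_re_le_norm _).trans this
  rw [Complex.sub_re, primitive_imaginary_axis_re hG h0, sub_zero] at h
  rwa [← descentCurve_re]
end

/-- With L the limit of G at +∞ on the real axis, the symmetry of G makes the improper integral L +
conj L = 2 Re L. The real part of G tends to 0 at the left end of the curve, so Re L is also the
real part of the integral along the whole curve. Convergence on the real line is a conclusion here,
not an input. -/
theorem tendsto_integral_quinticExp {A B : ℝ} (hA : 0 < A) (hB : 0 ≤ B) :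
    Tendsto (fun p : ℝ × ℝ => ∫ t in p.1..p.2, quinticExp A B t) (atBot ×ˢ atTop)
      (𝓝 ((2 * (∫ σ, quinticExp A B (descentCurve σ) * descentVel σ).re : ℝ) : ℂ)) := by
  obtain ⟨G, h0, hG⟩ := exists_primitive_quinticExp A B
  set g := fun σ => quinticExp A B (descentCurve σ) * descentVel σ with hg
  have hint : MeasureTheory.Integrable g := integrable_quinticExp_descentCurve hA B
  have hcont : Continuous g := ((continuous_quinticExp A B).comp continuous_descentCurve).mul
    continuous_descentVel
  have hftc : ∀ a b : ℝ, ∫ σ in a..b, g σ = G (descentCurve b) - G (descentCurve a) := fun a b =>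
    intervalIntegral.integral_eq_sub_of_hasDerivAt
      (fun σ _ => hasDerivAt_primitive_descentCurve hG σ) (hcont.intervalIntegrable _ _)
  have hR : Tendsto (fun σ : ℝ => G (descentCurve σ)) atTop
      (𝓝 (G (descentCurve 0) + ∫ σ in Ioi 0, g σ)) := by
    have := (MeasureTheory.intervalIntegral_tendsto_integral_Ioi 0 hint.integrableOn
      tendsto_id).const_add (G (descentCurve 0))
    refine this.congr fun σ => ?_
    simp only [id, hftc]; ring
  have hL : Tendsto (fun σ : ℝ => G (descentCurve σ)) atBot
      (𝓝 (G (descentCurve 0) - ∫ σ in Iic 0, g σ)) := by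
    have := (MeasureTheory.intervalIntegral_tendsto_integral_Iic 0 hint.integrableOn
      tendsto_id).const_sub (G (descentCurve 0))
    refine this.congr fun σ => ?_
    simp only [id, hftc]; ring
  have hLre := tendsto_nhds_unique ((Complex.continuous_re.tendsto _).comp hL)
    (tendsto_primitive_re_atBot hG h0 hA hB)
  have hsum : ∫ σ, g σ = (∫ σ in Iic 0, g σ) + ∫ σ in Ioi 0, g σ := by
    rw [← Set.compl_Iic, MeasureTheory.integral_add_compl measurableSet_Iic hint]
  set L := G (descentCurve 0) + ∫ σ in Ioi 0, g σ with hLdef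
  have hreal : Tendsto (fun x : ℝ => G x) atTop (𝓝 L) := by
    have h1 := hR.sub (tendsto_primitive_sub_atTop hG hA hB)
    simp only [sub_sub_cancel, sub_zero] at h1
    -- The substitution σ = log(x√2) makes the abscissa of the curve equal to x.
    have h2 : Tendsto (fun x : ℝ => Real.log (x * √2)) atTop atTop :=
      Real.tendsto_log_atTop.comp (tendsto_id.atTop_mul_const (by positivity))
    refine (h1.comp h2).congr' ?_
    filter_upwards [eventually_gt_atTop 0] with x hx
    simp only [Function.comp]
    rw [Real.exp_log (by positivity), mul_div_assoc, div_self (by positivity), mul_one]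
  have hreal' : Tendsto (fun x : ℝ => G x) atBot (𝓝 (-(starRingEnd ℂ) L)) := by
    have h1 := ((Complex.continuous_conj.tendsto L).comp (hreal.comp tendsto_neg_atBot_atTop)).neg
    refine h1.congr fun x => ?_
    simp only [Function.comp]
    rw [← primitive_neg_real hG h0, neg_neg]
  have hlim : ((2 * (∫ σ, g σ).re : ℝ) : ℂ) = L - -(starRingEnd ℂ) L := by
    rw [sub_neg_eq_add, Complex.add_conj]
    congr 2
    rw [hsum, hLdef]
    simp only [Complex.add_re, Complex.sub_re] at hLre ⊢
    linarith
  rw [hlim]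
  refine ((hreal.comp tendsto_snd).sub (hreal'.comp tendsto_fst)).congr fun p => ?_
  rw [integral_quinticExp_real hG]; rfl

/-! ### The swallowtail integral as a contour integral, and its scaling. -/

lemma swallowtailTrunc_eq (z a b : ℝ) :
    swallowtailTrunc 0 0 z a b = ∫ t in a..b, quinticExp 1 z t := by
  unfold swallowtailTrunc quinticExp
  congr 1; funext t
  congr 1; push_cast; ring

/-- The contour integral representing half of `Q(0,0,z)` along the fixed curve. -/
noncomputable def swallowtailHalf (B : ℂ) : ℂ :=
  ∫ σ, quinticExp 1 B (descentCurve σ) * descentVel σ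

theorem tendsto_swallowtailTrunc {z : ℝ} (hz : 0 ≤ z) :
    Tendsto (fun p : ℝ × ℝ => swallowtailTrunc 0 0 z p.1 p.2) (atBot ×ˢ atTop)
      (𝓝 ((2 * (swallowtailHalf z).re : ℝ) : ℂ)) := by
  simp_rw [swallowtailTrunc_eq]
  exact tendsto_integral_quinticExp one_pos hz

lemma swallowtailQ_eq_half {z : ℝ} (hz : 0 ≤ z) :
    swallowtailQ 0 0 z = ((2 * (swallowtailHalf z).re : ℝ) : ℂ) :=
  (tendsto_swallowtailTrunc hz).limUnder_eq

lemma swallowtailTrunc_scaling {z : ℝ} (hz : 0 < z) (a b : ℝ) :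
    swallowtailTrunc 0 0 z (z ^ (1 / 4 : ℝ) * a) (z ^ (1 / 4 : ℝ) * b) =
      ((z ^ (1 / 4 : ℝ) : ℝ) : ℂ) * ∫ t in a..b, quinticExp (z ^ (5 / 4 : ℝ)) (z ^ (5 / 4 : ℝ) : ℝ) t := by
  have hc : 0 < z ^ (1 / 4 : ℝ) := by positivity
  have h5 : (z ^ (1 / 4 : ℝ)) ^ 5 = z ^ (5 / 4 : ℝ) := by
    rw [← Real.rpow_natCast, ← Real.rpow_mul hz.le]; norm_num
  have h4 : (z ^ (1 / 4 : ℝ)) ^ 4 = z := by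
    rw [← Real.rpow_natCast, ← Real.rpow_mul hz.le]; norm_num
  rw [swallowtailTrunc_eq, ← h5]
  set c := z ^ (1 / 4 : ℝ)
  rw [← intervalIntegral.smul_integral_comp_mul_left, ← Complex.real_smul]
  congr 2; funext t
  rw [quinticExp, quinticExp, ← h4]
  congr 1; push_cast; ring

lemma pathIntegral_descentCurve (lam : ℝ) : pathIntegral descentCurve lam =
    ∫ σ, quinticExp lam lam (descentCurve σ) * descentVel σ := by
  rw [pathIntegral, pathIntegrand_descentCurve]

lemma tendsto_scale_atBot_atTop {c : ℝ} (hc : 0 < c) :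
    Tendsto (fun p : ℝ × ℝ => (c * p.1, c * p.2)) (atBot ×ˢ atTop) (atBot ×ˢ atTop) :=
  ((tendsto_id.const_mul_atBot hc).comp tendsto_fst).prodMk
    ((tendsto_id.const_mul_atTop hc).comp tendsto_snd)

lemma swallowtailQ_eq_mul_of_scaling {z c l : ℝ} (hz : 0 < z) (hc : 0 < c) (hl : 0 < l)
    (h : ∀ a b, swallowtailTrunc 0 0 z (c * a) (c * b) = c * ∫ t in a..b, quinticExp l l t) :
    swallowtailQ 0 0 z = c * ((2 * (pathIntegral descentCurve l).re : ℝ) : ℂ) := by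
  have h1 := (tendsto_integral_quinticExp hl hl.le).const_mul (c : ℂ)
  have h3 := (tendsto_swallowtailTrunc hz.le).comp (tendsto_scale_atBot_atTop hc)
  rw [← swallowtailQ_eq_half hz.le] at h3
  rw [pathIntegral_descentCurve]
  exact tendsto_nhds_unique (h3.congr fun p : ℝ × ℝ => h p.1 p.2) h1

theorem swallowtailQ_eq_pathIntegral {z : ℝ} (hz : 0 < z) : swallowtailQ 0 0 z =
    ((z ^ (1 / 4 : ℝ) * (2 * (pathIntegral descentCurve (z ^ (5 / 4 : ℝ))).re) : ℝ) : ℂ) := by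
  rw [swallowtailQ_eq_mul_of_scaling hz (by positivity) (by positivity)
    (swallowtailTrunc_scaling hz), ← Complex.ofReal_mul]

/-! ### Laplace's method on the steepest descent curve -/

/-- Off the saddle a zero of the cofactor would force height 0; at the saddle it is 10 t_0³. -/
lemma saddleCofactor_descentCurve_ne_zero (σ : ℝ) : saddleCofactor (descentCurve σ) ≠ 0 := by
  rcases eq_or_ne σ 0 with rfl | h
  · rw [descentCurve_zero, saddleCofactor]
    have h0 : saddlePlus 0 ≠ 0 := by
      intro h; have := saddlePlus_zero_pow_four; rw [h] at this; norm_num at this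
    have : saddlePlus 0 ^ 3 + 2 * saddlePlus 0 * saddlePlus 0 ^ 2 +
      3 * saddlePlus 0 ^ 2 * saddlePlus 0 + 4 * saddlePlus 0 ^ 3 = 10 * saddlePlus 0 ^ 3 := by ring
    rw [this]
    exact mul_ne_zero (by norm_num) (pow_ne_zero _ h0)
  · intro h0
    have := descentHeight_pos h
    rw [descentHeight_eq_mul, h0] at this
    simp at this

lemma continuous_saddleCofactor : Continuous saddleCofactor := by
  unfold saddleCofactor; fun_prop

lemma mul_abs_le_abs_exp_sub_one {M σ : ℝ} (hσ : |σ| ≤ M) :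
    Real.exp (-M) * |σ| ≤ |Real.exp σ - 1| := by
  have hM : 0 ≤ M := (abs_nonneg σ).trans hσ
  rw [abs_le] at hσ
  rcases le_total 0 σ with h | h
  · have h1 := Real.add_one_le_exp σ
    rw [abs_of_nonneg h, abs_of_nonneg (by linarith)]
    have : Real.exp (-M) ≤ 1 := Real.exp_le_one_iff.2 (by linarith)
    nlinarith
  · have h1 := Real.add_one_le_exp (-σ)
    have h2 : Real.exp σ ≤ 1 := Real.exp_le_one_iff.2 h
    rw [abs_of_nonpos h, abs_of_nonpos (by linarith)]
    have h3 : Real.exp σ * Real.exp (-σ) = 1 := by rw [← Real.exp_add]; simp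
    have h4 : Real.exp (-M) ≤ Real.exp σ := Real.exp_le_exp.2 hσ.1
    nlinarith [Real.exp_pos σ]

lemma sq_le_descentHeight_of_large {σ : ℝ} (h : 1000 ≤ |σ|) : σ ^ 2 ≤ descentHeight σ := by
  have h1 := exp_le_norm_descentCurve σ
  have h2 := norm_pow_five_le_descentHeight σ
  have h3 := Real.pow_div_factorial_le_exp (|σ| / 4) (by positivity) 2
  set x := ‖descentCurve σ‖
  -- From e^y ≥ y²/2 at y = |σ|/4, divided by 3. For |σ| ≥ 1000 this makes |t| so large that its
  -- fifth power exceeds σ² with room to spare.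
  have h4 : σ ^ 2 / 96 ≤ x := by
    norm_num [Nat.factorial, div_pow, sq_abs] at h3
    linarith
  have h5 : (1000 : ℝ) ^ 2 ≤ σ ^ 2 := by rw [← sq_abs σ]; gcongr
  have h6 : 10 ≤ x := by linarith
  have h7 : (10 : ℝ) ^ 4 ≤ x ^ 4 := by gcongr
  have h8 : (10 : ℝ) ^ 4 * x ≤ x ^ 4 * x := by gcongr
  nlinarith

/-- On a compact interval the cofactor is bounded below and |t - t_0| is at least its real part |e^σ
- 1|/√2; outside it the growth of |t|⁵ takes over. -/
lemma exists_sq_le_descentHeight : ∃ c, 0 < c ∧ ∀ σ, c * σ ^ 2 ≤ descentHeight σ := by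
  obtain ⟨σ₀, -, hmin⟩ := (isCompact_Icc (a := (-1000 : ℝ)) (b := 1000)).exists_isMinOn
    ⟨0, by norm_num⟩
    (continuous_saddleCofactor.comp continuous_descentCurve).norm.continuousOn
  set m := ‖saddleCofactor (descentCurve σ₀)‖ with hm
  have hm0 : 0 < m := norm_pos_iff.2 (saddleCofactor_descentCurve_ne_zero σ₀)
  set c := Real.exp (-1000) ^ 2 / 2 * m / 5 with hc
  refine ⟨min c 1, by positivity, fun σ => ?_⟩
  rcases le_total |σ| 1000 with h | h
  · refine (mul_le_mul_of_nonneg_right (min_le_left _ _) (sq_nonneg σ)).trans ?_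
    have h1 : m ≤ ‖saddleCofactor (descentCurve σ)‖ := hmin (abs_le.1 h)
    have h2 : |Real.exp σ - 1| / √2 ≤ ‖descentCurve σ - saddlePlus 0‖ := by
      refine le_trans (le_of_eq ?_) (Complex.abs_re_le_norm _)
      have h0 : (1 : ℝ) / √2 = (saddlePlus 0).re := by
        rw [← descentCurve_zero, descentCurve_re, Real.exp_zero]
      rw [Complex.sub_re, descentCurve_re, ← h0, ← sub_div, abs_div, abs_of_pos (by positivity : 0 < √2)]
    have h3 := mul_abs_le_abs_exp_sub_one h
    have h4 : (Real.exp (-1000) * |σ| / √2) ^ 2 ≤ ‖descentCurve σ - saddlePlus 0‖ ^ 2 := by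
      gcongr
      exact (div_le_div_of_nonneg_right h3 (by positivity)).trans h2
    rw [div_pow, mul_pow, sq_abs, Real.sq_sqrt (by norm_num)] at h4
    rw [descentHeight_eq_mul, hc]
    calc _ = (Real.exp (-1000) ^ 2 * σ ^ 2 / 2) * m / 5 := by ring
      _ ≤ _ := by gcongr
  · refine (mul_le_mul_of_nonneg_right (min_le_right _ _) (sq_nonneg σ)).trans ?_
    rw [one_mul]
    exact sq_le_descentHeight_of_large h

lemma norm_saddleCofactor_saddle : ‖saddleCofactor (saddlePlus 0)‖ = 10 := by
  have : saddleCofactor (saddlePlus 0) = 10 * saddlePlus 0 ^ 3 := by rw [saddleCofactor]; ring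
  rw [this, norm_mul, norm_pow, norm_saddlePlus_zero]; norm_num

/-- The factorisation of the height reduces its quadratic behaviour at 0 to the first derivative of
the curve; the factor 2 is 10/5, from the cofactor at the saddle. -/
lemma tendsto_mul_descentHeight (x : ℝ) :
    Tendsto (fun lam : ℝ => lam * descentHeight (x / √lam)) atTop
      (𝓝 (2 * ‖descentVel 0‖ ^ 2 * x ^ 2)) := by
  have hd : Tendsto (fun lam : ℝ => √lam • (descentCurve (0 + (√lam)⁻¹ • x) - descentCurve 0))
      atTop (𝓝 ((ContinuousLinearMap.toSpanSingleton ℝ (descentVel 0)) x)) :=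
    (hasDerivAt_descentCurve 0).hasFDerivAt.lim x
      (tendsto_norm_atTop_atTop.comp Real.tendsto_sqrt_atTop)
  have harg : Tendsto (fun lam : ℝ => 0 + (√lam)⁻¹ • x) atTop (𝓝 0) := by
    have := (tendsto_inv_atTop_zero.comp Real.tendsto_sqrt_atTop).smul_const x
    simpa using this
  have hq := ((continuous_saddleCofactor.comp continuous_descentCurve).norm.tendsto 0).comp harg
  simp only [Function.comp, descentCurve_zero, norm_saddleCofactor_saddle] at hq
  have := ((hd.norm.pow 2).mul hq).div_const 5
  have e : ‖(ContinuousLinearMap.toSpanSingleton ℝ (descentVel 0)) x‖ ^ 2 * 10 / 5 =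
      2 * ‖descentVel 0‖ ^ 2 * x ^ 2 := by
    rw [ContinuousLinearMap.toSpanSingleton_apply, norm_smul, Real.norm_eq_abs, mul_pow, sq_abs]
    ring
  rw [e] at this
  refine this.congr' ?_
  filter_upwards [eventually_ge_atTop 0] with lam hl
  rw [descentHeight_eq_mul, norm_smul, mul_pow, Real.norm_eq_abs, sq_abs, Real.sq_sqrt hl,
    descentCurve_zero, Function.comp, zero_add, smul_eq_mul, div_eq_inv_mul x]
  ring

/-- The target space is general because the result is applied to γ' and also to the real function
|γ'|. -/
theorem tendsto_laplace_descentHeight {E : Type*} [NormedAddCommGroup E] [NormedSpace ℝ E]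
    [CompleteSpace E] {φ : ℝ → E} (hφ : Continuous φ) {C : ℝ}
    (hC : ∀ σ, ‖φ σ‖ ≤ C * Real.exp (3 * |σ|)) :
    Tendsto (fun lam : ℝ => √lam • ∫ σ, Real.exp (-(lam * descentHeight σ)) • φ σ) atTop
      (𝓝 (√(Real.pi / (2 * ‖descentVel 0‖ ^ 2)) • φ 0)) := by
  obtain ⟨c, hc, hR⟩ := exists_sq_le_descentHeight
  have hC0 : 0 ≤ C := by
    have := (norm_nonneg _).trans (hC 0)
    simpa using this
  have e : √(Real.pi / (2 * ‖descentVel 0‖ ^ 2)) • φ 0 =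
      ∫ x : ℝ, Real.exp (-(2 * ‖descentVel 0‖ ^ 2 * x ^ 2)) • φ 0 := by
    rw [integral_smul_const, ← integral_gaussian]
    simp only [neg_mul]
  rw [e]
  have hmain : Tendsto (fun lam : ℝ => ∫ x : ℝ, Real.exp (-(lam * descentHeight (x / √lam))) •
      φ (x / √lam)) atTop (𝓝 (∫ x : ℝ, Real.exp (-(2 * ‖descentVel 0‖ ^ 2 * x ^ 2)) • φ 0)) := by
    refine MeasureTheory.tendsto_integral_filter_of_dominated_convergence
      (fun x => C * Real.exp (9 / (2 * c)) * Real.exp (-(c / 2) * x ^ 2)) ?_ ?_ ?_ ?_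
    · refine Eventually.of_forall fun lam => Continuous.aestronglyMeasurable ?_
      have := continuous_descentHeight
      fun_prop
    · filter_upwards [eventually_ge_atTop 1] with lam hl
      refine MeasureTheory.ae_of_all _ fun x => ?_
      have hs : 1 ≤ √lam := Real.one_le_sqrt.2 hl
      have h1 : c * x ^ 2 ≤ lam * descentHeight (x / √lam) := by
        have := mul_le_mul_of_nonneg_left (hR (x / √lam)) (by linarith : 0 ≤ lam)
        rw [div_pow, Real.sq_sqrt (by linarith)] at this
        have e : lam * (c * (x ^ 2 / lam)) = c * x ^ 2 := by field_simp
        rwa [e] at this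
      have h2 : |x / √lam| ≤ |x| := by
        rw [abs_div, abs_of_pos (by linarith : 0 < √lam)]
        exact div_le_self (abs_nonneg x) hs
      -- Half of the Gaussian decay is spent on the exponential growth of φ.
      have h3 : 3 * |x| ≤ c / 2 * x ^ 2 + 9 / (2 * c) := by
        have : c / 2 * x ^ 2 + 9 / (2 * c) - 3 * |x| = (c * |x| - 3) ^ 2 / (2 * c) := by
          rw [← sq_abs x]; field_simp; ring
        have : 0 ≤ (c * |x| - 3) ^ 2 / (2 * c) := by positivity
        linarith
      rw [norm_smul, Real.norm_of_nonneg (Real.exp_pos _).le]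
      calc _ ≤ Real.exp (-(c * x ^ 2)) * (C * Real.exp (3 * |x|)) := by
            refine mul_le_mul (Real.exp_le_exp.2 (by linarith)) ((hC _).trans ?_)
              (norm_nonneg _) (Real.exp_pos _).le
            gcongr
        _ ≤ Real.exp (-(c * x ^ 2)) * (C * Real.exp (c / 2 * x ^ 2 + 9 / (2 * c))) := by gcongr
        _ = C * Real.exp (9 / (2 * c)) * Real.exp (-(c / 2) * x ^ 2) := by
            have : Real.exp (-(c / 2) * x ^ 2) =
              Real.exp (-(c * x ^ 2)) * Real.exp (c / 2 * x ^ 2) := by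
              rw [← Real.exp_add]; congr 1; ring
            rw [this, Real.exp_add]; ring
    · exact (integrable_exp_neg_mul_sq (by positivity)).const_mul _
    · refine MeasureTheory.ae_of_all _ fun x => ?_
      have harg : Tendsto (fun lam : ℝ => x / √lam) atTop (𝓝 0) :=
        tendsto_const_nhds.div_atTop Real.tendsto_sqrt_atTop
      exact ((Real.continuous_exp.tendsto _).comp (tendsto_mul_descentHeight x).neg).smul
        ((hφ.tendsto 0).comp harg)
  refine hmain.congr' ?_
  filter_upwards [eventually_gt_atTop 0] with lam hl
  have := MeasureTheory.Measure.integral_comp_div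
    (fun σ => Real.exp (-(lam * descentHeight σ)) • φ σ) (√lam)
  rw [this, abs_of_pos (Real.sqrt_pos.2 hl)]

/-- The amplitude of the saddle contribution, with the exponential factor removed. -/
noncomputable def saddleAmp (lam : ℝ) : ℂ :=
  ∫ σ, Real.exp (-(lam * descentHeight σ)) • descentVel σ

lemma pathIntegral_eq_saddleAmp (lam : ℝ) : pathIntegral descentCurve lam =
    Complex.exp (Complex.I * lam * phasePlus (saddlePlus 0)) * saddleAmp lam := by
  rw [pathIntegral, saddleAmp, ← MeasureTheory.integral_const_mul]
  congr 1; funext σ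
  rw [pathIntegrand, deriv_descentCurve, phasePlus_descentCurve, Complex.real_smul, ← mul_assoc,
    Complex.ofReal_exp, ← Complex.exp_add]
  congr 2
  push_cast
  linear_combination (lam * descentHeight σ : ℂ) * Complex.I_sq

lemma descentVel_zero : descentVel 0 =
    (√(2 - √2) : ℂ) * Complex.exp (-(Real.pi / 8 : ℝ) * Complex.I) := by
  have h2 : √2 ^ 2 = 2 := Real.sq_sqrt (by norm_num)
  have hp : 0 < √2 := by positivity
  have hlt : √2 < 2 := by rw [Real.sqrt_lt' (by norm_num)]; norm_num
  have hw : descentSq 1 = 1 / 2 := by norm_num [descentSq]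
  have hr : descentRad 1 = √2 := by rw [descentRad]; norm_num
  have hd : descentSqDeriv 1 = 1 - √2 := by rw [descentSqDeriv, hr]; norm_num
  have hv : √(1 / 2 : ℝ) = 1 / √2 := by rw [Real.sqrt_div (by norm_num), Real.sqrt_one]
  rw [← Complex.ofReal_neg]
  apply Complex.ext
  · rw [descentVel_re, Complex.re_ofReal_mul, Complex.exp_ofReal_mul_I_re, Real.cos_neg,
      Real.cos_pi_div_eight, Real.exp_zero]
    rw [mul_div_assoc', ← Real.sqrt_mul (by linarith)]
    have : (2 - √2) * (2 + √2) = 2 := by linear_combination -h2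
    rw [this, div_eq_div_iff hp.ne' (by norm_num)]
    linear_combination -h2
  · rw [descentVel_im, Complex.im_ofReal_mul, Complex.exp_ofReal_mul_I_im, Real.sin_neg,
      Real.sin_pi_div_eight, Real.exp_zero, hd, hw, hv]
    have : √(2 - √2) * -(√(2 - √2) / 2) = -(√(2 - √2) ^ 2 / 2) := by ring
    rw [this, Real.sq_sqrt (by linarith)]
    field_simp
    linear_combination -h2

lemma norm_descentVel_zero_sq : ‖descentVel 0‖ ^ 2 = 2 - √2 := by
  have hlt : √2 < 2 := by rw [Real.sqrt_lt' (by norm_num)]; norm_num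
  rw [descentVel_zero, norm_mul, ← Complex.ofReal_neg, Complex.norm_exp_ofReal_mul_I, mul_one,
    Complex.norm_real, Real.norm_of_nonneg (Real.sqrt_nonneg _), Real.sq_sqrt (by linarith)]

theorem tendsto_sqrt_mul_saddleAmp :
    Tendsto (fun lam : ℝ => (√lam : ℂ) * saddleAmp lam) atTop
      (𝓝 ((√(Real.pi / 2) : ℂ) * Complex.exp (-(Real.pi / 8 : ℝ) * Complex.I))) := by
  have h := tendsto_laplace_descentHeight continuous_descentVel norm_descentVel_le
  have hlt : √2 < 2 := by rw [Real.sqrt_lt' (by norm_num)]; norm_num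
  rw [norm_descentVel_zero_sq, descentVel_zero, Complex.real_smul, ← mul_assoc,
    ← Complex.ofReal_mul, ← Real.sqrt_mul (by
      have : 0 < 2 - √2 := by linarith
      positivity)] at h
  have e : Real.pi / (2 * (2 - √2)) * (2 - √2) = Real.pi / 2 := by
    have : 2 - √2 ≠ 0 := by linarith
    field_simp
  rw [e] at h
  simpa only [saddleAmp, Complex.real_smul] using h

/-! ### Analyticity in `z` -/

/-- On the curve the decay is strong enough for complex B and for the extra factor t. The value ‖B‖
+ 1 makes the majorant uniform on the unit ball around B. -/
lemma hasDerivAt_swallowtailHalf (B : ℂ) : HasDerivAt swallowtailHalf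
    (∫ σ, Complex.I * descentCurve σ * quinticExp 1 B (descentCurve σ) * descentVel σ) B := by
  obtain ⟨C, hC⟩ := exists_descent_bound 1 1 (‖B‖ + 1) one_pos (by positivity)
  have hc := continuous_descentCurve
  have hv := continuous_descentVel
  have hm : ∀ B : ℂ, Continuous fun σ => quinticExp 1 B (descentCurve σ) :=
    fun B => (continuous_quinticExp 1 B).comp hc
  refine (hasDerivAt_integral_of_dominated_loc_of_deriv_le
    (F := fun B σ => quinticExp 1 B (descentCurve σ) * descentVel σ)
    (F' := fun B σ => Complex.I * descentCurve σ * quinticExp 1 B (descentCurve σ) * descentVel σ)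
    (bound := fun σ => C * Real.exp (-|σ|)) (Metric.ball_mem_nhds B one_pos)
    (Eventually.of_forall fun B => ((hm B).mul hv).aestronglyMeasurable)
    (integrable_quinticExp_descentCurve one_pos B) (by
      have := hm B
      exact Continuous.aestronglyMeasurable (by fun_prop))
    (MeasureTheory.ae_of_all _ fun σ B' hB' => ?_) (integrable_exp_neg_abs.const_mul C)
    (MeasureTheory.ae_of_all _ fun σ B' _ => ?_)).2
  · refine le_trans ?_ (hC σ)
    have h1 : ‖B'‖ ≤ ‖B‖ + 1 := by
      have h2 : ‖B' - B‖ < 1 := by simpa [dist_eq_norm] using hB'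
      have h3 := norm_le_norm_add_norm_sub' B' B
      linarith
    have h2 : ‖quinticExp 1 B' (descentCurve σ)‖ ≤
        Real.exp (1 * (2 + ‖descentCurve σ‖ - ‖descentCurve σ‖ ^ 5 / 10) +
          (‖B‖ + 1) * ‖descentCurve σ‖) := by
      refine (norm_quinticExp_descentCurve_le one_pos B' σ).trans (Real.exp_le_exp.2 ?_)
      gcongr
    rw [norm_mul, norm_mul, norm_mul, Complex.norm_I, one_mul, pow_one, mul_assoc]
    gcongr
  · refine HasDerivAt.mul_const ?_ (descentVel σ)
    have h := ((((hasDerivAt_id B').mul_const (descentCurve σ)).const_add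
      (((1 : ℝ) : ℂ) * descentCurve σ ^ 5 / 5)).const_mul Complex.I).cexp
    refine HasDerivAt.congr_deriv (f := fun B => quinticExp 1 B (descentCurve σ)) h ?_
    simp only [id, quinticExp]
    ring

/-- The function `z ↦ Q(0,0,z)`, as a real function which is analytic on the whole line. -/
noncomputable def swallowtailReal (z : ℝ) : ℝ := 2 * (swallowtailHalf z).re

lemma swallowtailQ_eq_real {z : ℝ} (hz : 0 ≤ z) : swallowtailQ 0 0 z = swallowtailReal z :=
  swallowtailQ_eq_half hz

lemma analyticOnNhd_swallowtailReal : AnalyticOnNhd ℝ swallowtailReal univ := by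
  intro z _
  have hd : Differentiable ℂ swallowtailHalf := fun B =>
    (hasDerivAt_swallowtailHalf B).differentiableAt
  have h1 : AnalyticAt ℝ swallowtailHalf (z : ℂ) := (hd.analyticAt z).restrictScalars
  have h2 : AnalyticAt ℝ (fun z : ℝ => (z : ℂ)) z := Complex.ofRealCLM.analyticAt z
  have h3 : AnalyticAt ℝ (fun z : ℝ => swallowtailHalf z) z := h1.comp h2
  exact analyticAt_const.mul ((Complex.reCLM.analyticAt _).comp h3)

lemma continuous_swallowtailReal : Continuous swallowtailReal :=
  continuous_iff_continuousAt.2 fun z => (analyticOnNhd_swallowtailReal z (mem_univ z)).continuousAt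

/-! ### The normalized amplitude -/

/-- `saddleAmp`, normalized so that it tends to one. -/
noncomputable def saddleAmpNorm (lam : ℝ) : ℂ :=
  Complex.exp ((Real.pi / 8 : ℝ) * Complex.I) * ((√(2 / Real.pi) : ℂ) * (√lam * saddleAmp lam))

lemma tendsto_saddleAmpNorm : Tendsto saddleAmpNorm atTop (𝓝 1) := by
  have h := (tendsto_sqrt_mul_saddleAmp.const_mul (√(2 / Real.pi) : ℂ)).const_mul
    (Complex.exp ((Real.pi / 8 : ℝ) * Complex.I))
  have e : Complex.exp ((Real.pi / 8 : ℝ) * Complex.I) * ((√(2 / Real.pi) : ℂ) *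
      ((√(Real.pi / 2) : ℂ) * Complex.exp (-(Real.pi / 8 : ℝ) * Complex.I))) = 1 := by
    rw [← mul_assoc (√(2 / Real.pi) : ℂ), ← Complex.ofReal_mul, ← Real.sqrt_mul (by positivity),
      show 2 / Real.pi * (Real.pi / 2) = 1 by field_simp, Real.sqrt_one, Complex.ofReal_one,
      one_mul, ← Complex.exp_add]
    simp
  rw [e] at h
  exact h

lemma tendsto_rpow_five_div_four : Tendsto (fun z : ℝ => z ^ (5 / 4 : ℝ)) atTop atTop :=
  tendsto_rpow_atTop (by norm_num)

lemma amplitudePlus_pos {z : ℝ} (hz : 0 < z) : 0 < amplitudePlus z := by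
  unfold amplitudePlus
  have := Real.pi_pos
  positivity

/-- An exact identity: i f(t_0) = 4(-1 + i)/(5√2) supplies the exponential factor and the phase, and
all the error is in `saddleAmpNorm`. -/
lemma swallowtailReal_eq {z : ℝ} (hz : 0 < z) : swallowtailReal z =
    amplitudePlus z * (Complex.exp (anglePlus z * Complex.I) * saddleAmpNorm (z ^ (5 / 4 : ℝ))).re := by
  have h := swallowtailQ_eq_pathIntegral hz
  rw [swallowtailQ_eq_real hz.le, Complex.ofReal_inj] at h
  rw [h, amplitudePlus, anglePlus, pathIntegral_eq_saddleAmp, phasePlus_saddlePlus_zero,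
    saddleAmpNorm]
  have hl : 0 < z ^ (5 / 4 : ℝ) := by positivity
  generalize z ^ (5 / 4 : ℝ) = l at *
  have e1 : Complex.exp (Complex.I * l * (((4 / (5 * √2) : ℝ) : ℂ) * (1 + Complex.I))) =
      ((Real.exp (-(4 * l / (5 * √2))) : ℝ) : ℂ) *
        Complex.exp (((4 * l / (5 * √2) : ℝ) : ℂ) * Complex.I) := by
    rw [Complex.ofReal_exp, ← Complex.exp_add]
    congr 1
    rw [show 4 * l / (5 * √2) = l * (4 / (5 * √2)) by ring]
    push_cast
    linear_combination (l * (4 / (5 * √2)) : ℂ) * Complex.I_sq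
  have e2 : Complex.exp (((4 * l / (5 * √2) - Real.pi / 8 : ℝ) : ℂ) * Complex.I) *
      (Complex.exp ((Real.pi / 8 : ℝ) * Complex.I) *
        ((√(2 / Real.pi) : ℂ) * (√l * saddleAmp l))) =
      ((√(2 / Real.pi) * √l : ℝ) : ℂ) *
        (Complex.exp (((4 * l / (5 * √2) : ℝ) : ℂ) * Complex.I) * saddleAmp l) := by
    rw [← mul_assoc, ← Complex.exp_add, ← add_mul, ← Complex.ofReal_add, sub_add_cancel]
    push_cast; ring
  rw [e1, e2, mul_assoc, Complex.re_ofReal_mul, Complex.re_ofReal_mul]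
  have e3 : √(2 * Real.pi / l) * (√(2 / Real.pi) * √l) = 2 := by
    rw [← Real.sqrt_mul (by positivity), ← Real.sqrt_mul (by positivity),
      show 2 * Real.pi / l * (2 / Real.pi * l) = 2 ^ 2 by field_simp]
    exact Real.sqrt_sq (by norm_num)
  linear_combination (-(z ^ (1 / 4 : ℝ)) * Real.exp (-(4 * l / (5 * √2))) *
    (Complex.exp (((4 * l / (5 * √2) : ℝ) : ℂ) * Complex.I) * saddleAmp l).re) * e3

lemma abs_swallowtailReal_sub_le {z : ℝ} (hz : 0 < z) :
    |swallowtailReal z - amplitudePlus z * Real.cos (anglePlus z)| ≤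
      amplitudePlus z * ‖saddleAmpNorm (z ^ (5 / 4 : ℝ)) - 1‖ := by
  rw [swallowtailReal_eq hz, ← mul_sub, abs_mul, abs_of_pos (amplitudePlus_pos hz)]
  refine mul_le_mul_of_nonneg_left ?_ (amplitudePlus_pos hz).le
  rw [← Complex.exp_ofReal_mul_I_re, ← Complex.sub_re]
  refine (Complex.abs_re_le_norm _).trans ?_
  rw [← mul_sub_one, norm_mul, Complex.norm_exp_ofReal_mul_I, one_mul]

lemma eventually_abs_swallowtailReal_sub_lt {δ : ℝ} (hδ : 0 < δ) : ∀ᶠ z : ℝ in atTop,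
    |swallowtailReal z - amplitudePlus z * Real.cos (anglePlus z)| < amplitudePlus z * δ := by
  have h := (tendsto_saddleAmpNorm.comp tendsto_rpow_five_div_four).sub_const 1 |>.norm
  simp only [sub_self, norm_zero] at h
  filter_upwards [h.eventually_lt_const hδ, eventually_gt_atTop 0] with z hz hz0
  exact (abs_swallowtailReal_sub_le hz0).trans_lt
    (mul_lt_mul_of_pos_left hz (amplitudePlus_pos hz0))

theorem swallowtailQ_asymptotics :
    (fun z : ℝ => swallowtailQ 0 0 z - ((amplitudePlus z * Real.cos (anglePlus z) : ℝ) : ℂ))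
      =o[atTop] amplitudePlus := by
  rw [isLittleO_iff]
  intro c hc
  filter_upwards [eventually_abs_swallowtailReal_sub_lt hc, eventually_gt_atTop 0] with z hz hz0
  rw [swallowtailQ_eq_real hz0.le, ← Complex.ofReal_sub, Complex.norm_real, Real.norm_eq_abs,
    Real.norm_of_nonneg (amplitudePlus_pos hz0).le, mul_comm c]
  exact hz.le

/-! ### The contributions of the two saddles -/

lemma iteratedDeriv_two_phasePlus (t : ℂ) : iteratedDeriv 2 phasePlus t = 4 * t ^ 3 := by
  have h : deriv phasePlus = fun t => t ^ 4 + 1 := funext fun t => (hasDerivAt_phasePlus t).deriv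
  rw [iteratedDeriv_succ, iteratedDeriv_one, h]
  have := ((hasDerivAt_pow 4 t).add_const 1).deriv
  rw [this]; push_cast; ring

lemma cpow_half_of_polar {r φ : ℝ} (hr : 0 < r) (h1 : -Real.pi < φ) (h2 : φ ≤ Real.pi) :
    ((r : ℂ) * Complex.exp (φ * Complex.I)) ^ (1 / 2 : ℂ) =
      (√r : ℂ) * Complex.exp ((φ / 2 : ℝ) * Complex.I) := by
  have hne : (r : ℂ) * Complex.exp (φ * Complex.I) ≠ 0 :=
    mul_ne_zero (by exact_mod_cast hr.ne') (Complex.exp_ne_zero _)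
  have hlog : Complex.log ((r : ℂ) * Complex.exp (φ * Complex.I)) =
      (Real.log r : ℂ) + φ * Complex.I := by
    rw [Complex.log_ofReal_mul hr (Complex.exp_ne_zero _), Complex.log_exp] <;> simpa
  rw [Complex.cpow_def_of_ne_zero hne, hlog, Real.sqrt_eq_rpow, Real.rpow_def_of_pos hr,
    Complex.ofReal_exp, ← Complex.exp_add]
  congr 1; push_cast; ring

lemma saddlePlus_zero_exp : saddlePlus 0 = Complex.exp ((Real.pi / 4 : ℝ) * Complex.I) := by
  rw [saddlePlus, pow_zero, one_mul]; congr 1; push_cast; ring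

/-- As t_0² = i, the quotient 2i/(4t_0³) is 1/(2t_0) = e^{-πi/4}/2. -/
lemma sqrt_saddle_zero : (2 * Complex.I / iteratedDeriv 2 phasePlus (saddlePlus 0)) ^ (1 / 2 : ℂ) =
    (√(1 / 2) : ℂ) * Complex.exp (-(Real.pi / 8 : ℝ) * Complex.I) := by
  have e : 2 * Complex.I / iteratedDeriv 2 phasePlus (saddlePlus 0) =
      ((1 / 2 : ℝ) : ℂ) * Complex.exp ((-(Real.pi / 4) : ℝ) * Complex.I) := by
    have h1 : saddlePlus 0 * Complex.exp ((-(Real.pi / 4) : ℝ) * Complex.I) = 1 := by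
      rw [saddlePlus_zero_exp, ← Complex.exp_add]; simp
    have h2 : saddlePlus 0 ^ 2 = Complex.I := by
      refine Eq.trans ?_ Complex.exp_pi_div_two_mul_I
      rw [saddlePlus_zero_exp, ← Complex.exp_nat_mul]
      congr 1; push_cast; ring
    have h0 : saddlePlus 0 ≠ 0 := left_ne_zero_of_mul_eq_one h1
    rw [iteratedDeriv_two_phasePlus, div_eq_iff (by simp [h0])]
    push_cast at h1 ⊢
    linear_combination (-2 * saddlePlus 0 ^ 2) * h1 - 2 * h2
  rw [e, cpow_half_of_polar (by norm_num) (by linarith [Real.pi_pos]) (by linarith [Real.pi_pos])]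
  congr 2; push_cast; ring

lemma conj_saddleContribution (lam : ℝ) : saddleContribution (saddlePlus 1) lam =
    (starRingEnd ℂ) (saddleContribution (saddlePlus 0) lam) := by
  have e : 2 * Complex.I / iteratedDeriv 2 phasePlus (saddlePlus 1) =
      (starRingEnd ℂ) (2 * Complex.I / iteratedDeriv 2 phasePlus (saddlePlus 0)) := by
    rw [iteratedDeriv_two_phasePlus, iteratedDeriv_two_phasePlus, saddlePlus_one_eq_refl]
    simp only [map_div₀, map_mul, map_pow, map_ofNat, Complex.conj_I]
    ring
  -- Conjugation commutes with the principal root only off the branch cut.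
  have harg : (2 * Complex.I / iteratedDeriv 2 phasePlus (saddlePlus 0)).arg ≠ Real.pi := by
    have : 2 * Complex.I / iteratedDeriv 2 phasePlus (saddlePlus 0) =
      ((√(1 / 2) : ℂ) * Complex.exp (-(Real.pi / 8 : ℝ) * Complex.I)) ^ 2 := by
      rw [← sqrt_saddle_zero, ← Complex.cpow_nat_mul]; simp
    rw [this, mul_pow, ← Complex.exp_nat_mul, ← Complex.ofReal_pow,
      Complex.arg_real_mul _ (by positivity)]
    rw [show ((2 : ℕ) : ℂ) * (-(Real.pi / 8 : ℝ) * Complex.I) =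
      ((-(Real.pi / 4) : ℝ) : ℂ) * Complex.I by push_cast; ring,
      Complex.arg_exp_mul_I, (toIocMod_eq_self _).2 ⟨by linarith [Real.pi_pos], by
        linarith [Real.pi_pos]⟩]
    linarith [Real.pi_pos]
  rw [saddleContribution, saddleContribution, e, map_mul, map_mul, Complex.conj_ofReal,
    ← Complex.exp_conj, Complex.conj_cpow _ _ harg, saddlePlus_one_eq_refl, phasePlus_neg_conj]
  simp only [map_mul, map_div₀, map_one, map_ofNat, Complex.conj_I, Complex.conj_ofReal]
  ring_nf

theorem pathIntegral_descentCurve_isEquivalent :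
    pathIntegral descentCurve ~[atTop] saddleContribution (saddlePlus 0) := by
  have hne : ∀ᶠ lam : ℝ in atTop, saddleContribution (saddlePlus 0) lam ≠ 0 := by
    filter_upwards [eventually_gt_atTop 0] with lam hl
    rw [saddleContribution, sqrt_saddle_zero]
    have : √(Real.pi / lam) ≠ 0 := by have := Real.pi_pos; positivity
    simp [this]
  rw [isEquivalent_iff_tendsto_one hne]
  refine tendsto_saddleAmpNorm.congr' ?_
  filter_upwards [eventually_gt_atTop 0, hne] with lam hl hn
  rw [Pi.div_apply, eq_div_iff hn, pathIntegral_eq_saddleAmp, saddleContribution, sqrt_saddle_zero,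
    saddleAmpNorm]
  have h1 : Complex.exp ((Real.pi / 8 : ℝ) * Complex.I) *
      Complex.exp (-(Real.pi / 8 : ℝ) * Complex.I) = 1 := by
    rw [← Complex.exp_add]; simp
  have h2 : (√(2 / Real.pi) : ℂ) * √lam * √(1 / 2) * √(Real.pi / lam) = 1 := by
    rw [← Complex.ofReal_mul, ← Complex.ofReal_mul, ← Complex.ofReal_mul,
      ← Real.sqrt_mul (by positivity), ← Real.sqrt_mul (by positivity),
      ← Real.sqrt_mul (by positivity),
      show 2 / Real.pi * lam * (1 / 2) * (Real.pi / lam) = 1 by field_simp]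
    simp
  generalize Complex.exp ((Real.pi / 8 : ℝ) * Complex.I) = E at *
  generalize Complex.exp (-(Real.pi / 8 : ℝ) * Complex.I) = E' at *
  generalize Complex.exp (Complex.I * lam * phasePlus (saddlePlus 0)) = X at *
  linear_combination (X * saddleAmp lam * E * E') * h2 + X * saddleAmp lam * h1

theorem pathIntegral_descentCurveRefl_isEquivalent :
    pathIntegral descentCurveRefl ~[atTop] saddleContribution (saddlePlus 1) := by
  have h := pathIntegral_descentCurve_isEquivalent.isLittleO
  rw [IsEquivalent, isLittleO_iff] at *
  intro c hc
  filter_upwards [h hc] with lam hl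
  rw [Pi.sub_apply, pathIntegral_descentCurveRefl, conj_saddleContribution, ← map_sub,
    RCLike.norm_conj, RCLike.norm_conj]
  exact hl

/-! ### The angle and its inverse -/

/-- The inverse of `anglePlus`. -/
noncomputable def anglePlusInv (α : ℝ) : ℝ :=
  (5 * √2 / 4 * (Real.pi / 8 + α)) ^ (4 / 5 : ℝ)

lemma anglePlus_anglePlusInv {α : ℝ} (h : 0 ≤ α) : anglePlus (anglePlusInv α) = α := by
  have := Real.pi_pos
  rw [anglePlus, anglePlusInv, ← Real.rpow_mul (by positivity)]
  norm_num
  field_simp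
  ring

lemma anglePlusInv_anglePlus {z : ℝ} (h : 0 ≤ z) : anglePlusInv (anglePlus z) = z := by
  rw [anglePlus, anglePlusInv]
  have : 5 * √2 / 4 * (Real.pi / 8 + (4 * z ^ (5 / 4 : ℝ) / (5 * √2) - Real.pi / 8)) =
    z ^ (5 / 4 : ℝ) := by field_simp; ring
  rw [this, ← Real.rpow_mul h]
  norm_num

lemma anglePlusInv_pos {α : ℝ} (h : 0 ≤ α) : 0 < anglePlusInv α := by
  unfold anglePlusInv
  have := Real.pi_pos
  positivity

lemma strictMonoOn_anglePlus : StrictMonoOn anglePlus (Ici 0) := by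
  intro a ha b _ hab
  have h1 : a ^ (5 / 4 : ℝ) < b ^ (5 / 4 : ℝ) := Real.rpow_lt_rpow ha hab (by norm_num)
  unfold anglePlus
  gcongr

lemma tendsto_anglePlus : Tendsto anglePlus atTop atTop := by
  have := (tendsto_rpow_five_div_four.const_mul_atTop (by norm_num : (0 : ℝ) < 4)).atTop_div_const
    (by positivity : 0 < 5 * √2)
  exact tendsto_atTop_add_const_right _ (-(Real.pi / 8)) this

lemma tendsto_anglePlusInv : Tendsto anglePlusInv atTop atTop := by
  refine (tendsto_rpow_atTop (by norm_num : (0 : ℝ) < 4 / 5)).comp ?_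
  exact (tendsto_atTop_add_const_left _ _ tendsto_id).const_mul_atTop (by positivity)

lemma tendsto_odd_half_pi (c : ℝ) :
    Tendsto (fun m : ℕ => (2 * m + 1) * Real.pi / 2 + c) atTop atTop := by
  refine tendsto_atTop_add_const_right _ _ (Tendsto.atTop_div_const (by norm_num) ?_)
  refine Tendsto.atTop_mul_const Real.pi_pos (tendsto_atTop_add_const_right _ _ ?_)
  exact tendsto_natCast_atTop_atTop.const_mul_atTop (by norm_num)

/-! ### Existence of zeros near the zeros of the cosine -/

/-- At angles ±ε/2 from a zero of the cosine the main term is ±sin(ε/2) times the amplitude, with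
opposite signs, and outweighs the error. Half of ε keeps the final inequality strict. -/
lemma eventually_exists_zero {ε : ℝ} (h0 : 0 < ε) (h1 : ε < Real.pi / 2) :
    ∀ᶠ m : ℕ in atTop, ∃ z : ℝ, 0 < z ∧ swallowtailReal z = 0 ∧
      |anglePlus z - (2 * m + 1) * Real.pi / 2| < ε := by
  have hδ : 0 < Real.sin (ε / 2) := Real.sin_pos_of_pos_of_lt_pi (by linarith) (by linarith)
  have hev := eventually_abs_swallowtailReal_sub_lt hδ
  have hl := (tendsto_anglePlusInv.comp (tendsto_odd_half_pi (-(ε / 2)))).eventually hev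
  have hr := (tendsto_anglePlusInv.comp (tendsto_odd_half_pi (ε / 2))).eventually hev
  filter_upwards [hl, hr] with m hl hr
  simp only [Function.comp] at hl hr
  have hm : (0 : ℝ) ≤ m := Nat.cast_nonneg m
  have hmp : 0 ≤ m * Real.pi := mul_nonneg hm Real.pi_pos.le
  have hl0 : 0 ≤ (2 * m + 1) * Real.pi / 2 + -(ε / 2) := by linarith
  have hr0 : 0 ≤ (2 * m + 1) * Real.pi / 2 + ε / 2 := by linarith
  rw [anglePlus_anglePlusInv hl0] at hl
  rw [anglePlus_anglePlusInv hr0] at hr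
  have hzl := anglePlusInv_pos hl0
  have hzr := anglePlusInv_pos hr0
  have hal := anglePlus_anglePlusInv hl0
  have har := anglePlus_anglePlusInv hr0
  set a := anglePlusInv ((2 * m + 1) * Real.pi / 2 + -(ε / 2))
  set b := anglePlusInv ((2 * m + 1) * Real.pi / 2 + ε / 2)
  have hab : a ≤ b := by
    rw [← strictMonoOn_anglePlus.le_iff_le hzl.le hzr.le, hal, har]; linarith
  have hcl : Real.cos ((2 * m + 1) * Real.pi / 2 + -(ε / 2)) = (-1) ^ m * Real.sin (ε / 2) := by
    rw [show (2 * m + 1) * Real.pi / 2 + -(ε / 2) = (Real.pi / 2 - ε / 2) + m * Real.pi by ring,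
      Real.cos_add_nat_mul_pi, Real.cos_pi_div_two_sub]
  have hcr : Real.cos ((2 * m + 1) * Real.pi / 2 + ε / 2) = -((-1) ^ m * Real.sin (ε / 2)) := by
    rw [show (2 * m + 1) * Real.pi / 2 + ε / 2 = (ε / 2 + Real.pi / 2) + m * Real.pi by ring,
      Real.cos_add_nat_mul_pi, Real.cos_add_pi_div_two]; ring
  rw [hcl, abs_lt] at hl
  rw [hcr, abs_lt] at hr
  have hsol : ∃ z ∈ Icc a b, swallowtailReal z = 0 := by
    rcases neg_one_pow_eq_or ℝ m with hm1 | hm1 <;> rw [hm1] at hl hr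
    · exact intermediate_value_Icc' hab continuous_swallowtailReal.continuousOn
        ⟨by linarith [hr.2], by linarith [hl.1]⟩
    · exact intermediate_value_Icc hab continuous_swallowtailReal.continuousOn
        ⟨by linarith [hl.2], by linarith [hr.1]⟩
  obtain ⟨z, hz, hz0⟩ := hsol
  have hzp : 0 < z := hzl.trans_le hz.1
  refine ⟨z, hzp, hz0, ?_⟩
  have h2 := (strictMonoOn_anglePlus.le_iff_le hzl.le hzp.le).2 hz.1
  have h3 := (strictMonoOn_anglePlus.le_iff_le hzp.le hzr.le).2 hz.2
  rw [hal] at h2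
  rw [har] at h3
  rw [abs_lt]
  constructor <;> linarith

lemma eventually_zero_near {ε : ℝ} (h0 : 0 < ε) (h1 : ε < Real.pi / 2) :
    ∀ᶠ z : ℝ in atTop, swallowtailReal z = 0 →
      ∃ m : ℕ, |anglePlus z - (2 * m + 1) * Real.pi / 2| < ε := by
  have hδ : 0 < Real.sin ε := Real.sin_pos_of_pos_of_lt_pi h0 (by linarith)
  filter_upwards [eventually_abs_swallowtailReal_sub_lt hδ, eventually_gt_atTop 0,
    tendsto_anglePlus.eventually_ge_atTop 0] with z hz hz0 hα hq
  rw [hq, zero_sub, abs_neg, abs_mul, abs_of_pos (amplitudePlus_pos hz0)] at hz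
  have hc := lt_of_mul_lt_mul_left hz (amplitudePlus_pos hz0).le
  set α := anglePlus z
  -- This m puts α within π/2 of (2m + 1)π/2, where |cos α| < sin ε can be inverted by monotonicity
  -- of sin.
  refine ⟨⌊α / Real.pi⌋₊, ?_⟩
  have hpi := Real.pi_pos
  have hf1 := Nat.floor_le (div_nonneg hα hpi.le)
  have hf2 := Nat.lt_floor_add_one (α / Real.pi)
  set m := ⌊α / Real.pi⌋₊
  rw [le_div_iff₀ hpi] at hf1
  rw [div_lt_iff₀ hpi] at hf2
  set β := α - (2 * m + 1) * Real.pi / 2 with hβ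
  have e : α = (β + Real.pi / 2) + m * Real.pi := by rw [hβ]; ring
  rw [e, Real.cos_add_nat_mul_pi, Real.cos_add_pi_div_two, abs_mul, abs_pow, abs_neg, abs_one,
    one_pow, one_mul, abs_neg, abs_lt] at hc
  have hb1 : -(Real.pi / 2) ≤ β := by rw [hβ]; linarith
  have hb2 : β ≤ Real.pi / 2 := by rw [hβ]; linarith
  rw [abs_lt]
  constructor
  · by_contra! h
    have := Real.strictMonoOn_sin.monotoneOn ⟨hb1, hb2⟩
      (⟨by linarith, by linarith⟩ : -ε ∈ Icc (-(Real.pi / 2)) (Real.pi / 2)) h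
    rw [Real.sin_neg] at this
    linarith [hc.1]
  · by_contra! h
    have := Real.strictMonoOn_sin.monotoneOn
      (⟨by linarith, by linarith⟩ : ε ∈ Icc (-(Real.pi / 2)) (Real.pi / 2)) ⟨hb1, hb2⟩ h
    linarith [hc.2]

/-! ### Uniqueness of the zero near a zero of the cosine -/

lemma integrable_saddleAmp {lam : ℝ} (h : 0 < lam) : MeasureTheory.Integrable
    (fun σ => Real.exp (-(lam * descentHeight σ)) • descentVel σ) := by
  refine ((integrable_pathIntegrand_descentCurve h).const_mul
    (Complex.exp (-(Complex.I * lam * phasePlus (saddlePlus 0))))).congr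
      (MeasureTheory.ae_of_all _ fun σ => ?_)
  simp only [pathIntegrand, deriv_descentCurve, phasePlus_descentCurve, Complex.real_smul,
    Complex.ofReal_exp]
  rw [← mul_assoc, ← Complex.exp_add]
  congr 2
  push_cast
  linear_combination (lam * descentHeight σ : ℂ) * Complex.I_sq

/-- The absolute version of `saddleAmp`. -/
noncomputable def saddleAmpAbs (lam : ℝ) : ℝ :=
  ∫ σ, Real.exp (-(lam * descentHeight σ)) * ‖descentVel σ‖

/-- A Lipschitz bound in λ without differentiating: |e^{-l₂R} - e^{-l₁R}| ≤ (l₂ - l₁) R e^{-l₁R},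
and R is absorbed by half of the exponential. -/
lemma norm_saddleAmp_sub_le {l₁ l₂ : ℝ} (h : 0 < l₁) (h12 : l₁ ≤ l₂) :
    ‖saddleAmp l₂ - saddleAmp l₁‖ ≤ (l₂ - l₁) * (2 / l₁ * saddleAmpAbs (l₁ / 2)) := by
  rw [saddleAmp, saddleAmp, ← MeasureTheory.integral_sub (integrable_saddleAmp (h.trans_le h12))
    (integrable_saddleAmp h), saddleAmpAbs, ← mul_assoc, ← MeasureTheory.integral_const_mul]
  have hint := (integrable_saddleAmp (half_pos h)).norm
  simp_rw [norm_smul, Real.norm_of_nonneg (Real.exp_pos _).le] at hint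
  refine MeasureTheory.norm_integral_le_of_norm_le (hint.const_mul _)
    (MeasureTheory.ae_of_all _ fun σ => ?_)
  rw [← sub_smul, norm_smul, ← mul_assoc]
  refine mul_le_mul_of_nonneg_right ?_ (norm_nonneg _)
  have hR := descentHeight_nonneg σ
  set R := descentHeight σ
  have h1 : Real.exp (-(l₂ * R)) = Real.exp (-(l₁ * R)) * Real.exp (-((l₂ - l₁) * R)) := by
    rw [← Real.exp_add]; congr 1; ring
  have h2 : 1 - (l₂ - l₁) * R ≤ Real.exp (-((l₂ - l₁) * R)) := by
    linarith [Real.add_one_le_exp (-((l₂ - l₁) * R))]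
  have h3 : Real.exp (-((l₂ - l₁) * R)) ≤ 1 :=
    Real.exp_le_one_iff.2 (by have := mul_nonneg (sub_nonneg.2 h12) hR; linarith)
  have h4 : Real.exp (-(l₁ * R)) = Real.exp (-(l₁ / 2 * R)) * Real.exp (-(l₁ / 2 * R)) := by
    rw [← Real.exp_add]; congr 1; ring
  have h5 : R * Real.exp (-(l₁ / 2 * R)) ≤ 2 / l₁ := by
    have := Real.add_one_le_exp (l₁ / 2 * R)
    rw [Real.exp_neg, ← div_eq_mul_inv, div_le_div_iff₀ (Real.exp_pos _) h]
    linarith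
  rw [h1, Real.norm_eq_abs, ← mul_sub_one, abs_mul, abs_of_pos (Real.exp_pos _),
    abs_of_nonpos (by linarith)]
  have hE := Real.exp_pos (-(l₁ / 2 * R))
  calc _ ≤ Real.exp (-(l₁ * R)) * ((l₂ - l₁) * R) := by
        refine mul_le_mul_of_nonneg_left (by linarith) (Real.exp_pos _).le
    _ = (l₂ - l₁) * (R * Real.exp (-(l₁ / 2 * R))) * Real.exp (-(l₁ / 2 * R)) := by
        rw [h4]; ring
    _ ≤ _ := by
        refine mul_le_mul_of_nonneg_right ?_ hE.le
        exact mul_le_mul_of_nonneg_left h5 (sub_nonneg.2 h12)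

/-- By Laplace's method √(l/2) · `saddleAmpAbs (l / 2)` converges, so the whole expression is
O(1/l). -/
lemma tendsto_saddleAmpAbs :
    Tendsto (fun l : ℝ => √l * (2 / l * saddleAmpAbs (l / 2))) atTop (𝓝 0) := by
  have h := tendsto_laplace_descentHeight continuous_descentVel.norm
    (fun σ => (norm_norm (descentVel σ)).le.trans (norm_descentVel_le σ))
  have h2 := h.comp (tendsto_id.atTop_div_const (by norm_num : (0 : ℝ) < 2))
  have h3 := (tendsto_inv_atTop_zero (𝕜 := ℝ)).const_mul (2 * √2)
  have h4 := h3.mul h2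
  rw [mul_zero, zero_mul] at h4
  refine h4.congr' ?_
  filter_upwards [eventually_gt_atTop 0] with l hl
  simp only [Function.comp, id, smul_eq_mul, saddleAmpAbs]
  rw [Real.sqrt_div hl.le]
  field_simp

lemma mul_abs_sub_le_abs_cos_sub_cos {α β ε : ℝ} {m : ℕ} (h1 : ε < Real.pi / 2)
    (hα : |α - (2 * m + 1) * Real.pi / 2| < ε) (hβ : |β - (2 * m + 1) * Real.pi / 2| < ε) :
    2 / Real.pi * Real.cos ε * |α - β| ≤ |Real.cos α - Real.cos β| := by
  rw [abs_lt] at hα hβ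
  have hε : 0 < ε := by linarith
  have hpi := Real.pi_pos
  rw [Real.cos_sub_cos, abs_mul, abs_mul, abs_neg, abs_two]
  set γ := (α + β) / 2 - (2 * m + 1) * Real.pi / 2 with hγ
  have e : (α + β) / 2 = (γ + Real.pi / 2) + m * Real.pi := by rw [hγ]; ring
  have hs : Real.cos ε ≤ |Real.sin ((α + β) / 2)| := by
    rw [e, Real.sin_add_nat_mul_pi, Real.sin_add_pi_div_two, abs_mul, abs_pow, abs_neg, abs_one,
      one_pow, one_mul]
    refine le_trans ?_ (le_abs_self _)
    rw [← Real.cos_abs γ]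
    refine Real.cos_le_cos_of_nonneg_of_le_pi (abs_nonneg _) (by linarith) ?_
    rw [abs_le]; constructor <;> linarith
  have hd : 2 / Real.pi * (|α - β| / 2) ≤ |Real.sin ((α - β) / 2)| := by
    have h2 : |α - β| ≤ Real.pi := by rw [abs_le]; constructor <;> linarith
    have h3 := Real.mul_le_sin (x := |α - β| / 2) (by positivity) (by linarith)
    refine h3.trans ?_
    have : |α - β| / 2 = |(α - β) / 2| := by rw [abs_div, abs_two]
    rw [this]
    rcases abs_choice ((α - β) / 2) with h | h <;> rw [h]
    · exact le_abs_self _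
    · rw [Real.sin_neg]; exact neg_le_abs _
  have hc : 0 ≤ Real.cos ε := Real.cos_nonneg_of_mem_Icc ⟨by linarith, by linarith⟩
  calc _ = 2 * Real.cos ε * (2 / Real.pi * (|α - β| / 2)) := by ring
    _ ≤ _ := by gcongr

lemma norm_exp_mul_I_sub_le (α β : ℝ) :
    ‖Complex.exp (α * Complex.I) - Complex.exp (β * Complex.I)‖ ≤ |α - β| := by
  have e : Complex.exp (α * Complex.I) - Complex.exp (β * Complex.I) =
      Complex.exp (β * Complex.I) * (Complex.exp (Complex.I * ((α - β : ℝ) : ℂ)) - 1) := by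
    rw [mul_sub_one, ← Complex.exp_add]; congr 2; push_cast; ring
  rw [e, norm_mul, Complex.norm_exp_ofReal_mul_I, one_mul]
  exact Real.norm_exp_I_mul_ofReal_sub_one_le

/-- Subtracting the two equations Re(e^{iα}K) = 0 bounds |cos α₂ - cos α₁| by a quantity tending to
0 times α₂ - α₁, against the lower bound (2/π) cos ε · (α₂ - α₁) inside the window. -/
lemma exists_zero_unique {ε : ℝ} (h0 : 0 < ε) (h1 : ε < Real.pi / 2) :
    ∃ Z, 0 < Z ∧ ∀ z₁ z₂ : ℝ, ∀ m : ℕ, Z ≤ z₁ → z₁ ≤ z₂ →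
      swallowtailReal z₁ = 0 → swallowtailReal z₂ = 0 →
      |anglePlus z₁ - (2 * m + 1) * Real.pi / 2| < ε →
      |anglePlus z₂ - (2 * m + 1) * Real.pi / 2| < ε → z₁ = z₂ := by
  set c := √(2 / Real.pi) with hc
  have hc0 : 0 < c := by have := Real.pi_pos; positivity
  have hcos : 0 < 2 / Real.pi * Real.cos ε :=
    mul_pos (by have := Real.pi_pos; positivity)
      (Real.cos_pos_of_mem_Ioo ⟨by linarith, by linarith⟩)
  have hη : Tendsto (fun z : ℝ => 2 * (c * (√(z ^ (5 / 4 : ℝ)) *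
      (2 / z ^ (5 / 4 : ℝ) * saddleAmpAbs (z ^ (5 / 4 : ℝ) / 2)))) +
      ‖saddleAmpNorm (z ^ (5 / 4 : ℝ)) - 1‖) atTop (𝓝 0) := by
    have h1 := ((tendsto_saddleAmpAbs.comp tendsto_rpow_five_div_four).const_mul c).const_mul 2
    have h2 := ((tendsto_saddleAmpNorm.comp tendsto_rpow_five_div_four).sub_const 1).norm
    have := h1.add h2
    simp only [mul_zero, sub_self, norm_zero, add_zero] at this
    exact this
  obtain ⟨Z, hZ⟩ := eventually_atTop.1 (hη.eventually_lt_const hcos)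
  refine ⟨max Z 1, by positivity, fun z₁ z₂ m hz1 h12 hq1 hq2 hw1 hw2 => ?_⟩
  have hz1p : 0 < z₁ := lt_of_lt_of_le (by positivity) hz1
  have hz2p := hz1p.trans_le h12
  have hbd := hZ z₁ ((le_max_left _ _).trans hz1)
  rw [swallowtailReal_eq hz1p, mul_eq_zero, or_iff_right (amplitudePlus_pos hz1p).ne'] at hq1
  rw [swallowtailReal_eq hz2p, mul_eq_zero, or_iff_right (amplitudePlus_pos hz2p).ne'] at hq2
  by_contra hne
  have hlt := strictMonoOn_anglePlus hz1p.le hz2p.le (lt_of_le_of_ne h12 hne)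
  have hcosd := mul_abs_sub_le_abs_cos_sub_cos h1 hw2 hw1
  have hl1 : 0 < z₁ ^ (5 / 4 : ℝ) := by positivity
  have hl2 : 0 < z₂ ^ (5 / 4 : ℝ) := by positivity
  have hl12 : z₁ ^ (5 / 4 : ℝ) ≤ z₂ ^ (5 / 4 : ℝ) := Real.rpow_le_rpow hz1p.le h12 (by norm_num)
  have hang : z₂ ^ (5 / 4 : ℝ) - z₁ ^ (5 / 4 : ℝ) ≤ 2 * (anglePlus z₂ - anglePlus z₁) := by
    have e : anglePlus z₂ - anglePlus z₁ =
      4 / (5 * √2) * (z₂ ^ (5 / 4 : ℝ) - z₁ ^ (5 / 4 : ℝ)) := by unfold anglePlus; ring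
    have h2 : 1 / 2 ≤ 4 / (5 * √2) := by
      have : √2 ≤ 8 / 5 := Real.sqrt_le_iff.2 ⟨by norm_num, by norm_num⟩
      rw [div_le_div_iff₀ (by norm_num) (by positivity)]
      linarith
    rw [e]
    nlinarith [mul_le_mul_of_nonneg_right h2 (sub_nonneg.2 hl12)]
  generalize z₁ ^ (5 / 4 : ℝ) = l₁ at *
  generalize z₂ ^ (5 / 4 : ℝ) = l₂ at *
  generalize anglePlus z₁ = α₁ at *
  generalize anglePlus z₂ = α₂ at *
  -- The normalised amplitude at l₂ with √l₁ in place of √l₂. A positive factor does not affect the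
  -- zero equation, and only the variation of `saddleAmp` remains to be estimated.
  set k := Complex.exp ((Real.pi / 8 : ℝ) * Complex.I) * ((c : ℂ) * (√l₁ * saddleAmp l₂)) with hk
  have hk2 : (Complex.exp (α₂ * Complex.I) * k).re = 0 := by
    have e : Complex.exp (α₂ * Complex.I) * saddleAmpNorm l₂ = ((√l₂ : ℝ) : ℂ) *
      (Complex.exp (α₂ * Complex.I) *
        (Complex.exp ((Real.pi / 8 : ℝ) * Complex.I) * (c * saddleAmp l₂))) := by
      rw [saddleAmpNorm]; ring
    rw [e, Complex.re_ofReal_mul, mul_eq_zero, or_iff_right (Real.sqrt_pos.2 hl2).ne'] at hq2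
    have e2 : Complex.exp (α₂ * Complex.I) * k = ((√l₁ : ℝ) : ℂ) *
      (Complex.exp (α₂ * Complex.I) *
        (Complex.exp ((Real.pi / 8 : ℝ) * Complex.I) * (c * saddleAmp l₂))) := by
      rw [hk]; ring
    rw [e2, Complex.re_ofReal_mul, hq2, mul_zero]
  have hkn : ‖k - saddleAmpNorm l₁‖ ≤
      (l₂ - l₁) * (c * (√l₁ * (2 / l₁ * saddleAmpAbs (l₁ / 2)))) := by
    have e : k - saddleAmpNorm l₁ = Complex.exp ((Real.pi / 8 : ℝ) * Complex.I) *
        ((c : ℂ) * ((√l₁ : ℂ) * (saddleAmp l₂ - saddleAmp l₁))) := by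
      rw [hk, saddleAmpNorm]; ring
    rw [e, norm_mul, Complex.norm_exp_ofReal_mul_I, one_mul, norm_mul, norm_mul,
      Complex.norm_real, Complex.norm_real, Real.norm_of_nonneg hc0.le,
      Real.norm_of_nonneg (Real.sqrt_nonneg _)]
    calc _ ≤ c * (√l₁ * ((l₂ - l₁) * (2 / l₁ * saddleAmpAbs (l₁ / 2)))) := by
          gcongr; exact norm_saddleAmp_sub_le hl1 hl12
      _ = _ := by ring
  have hid : Real.cos α₂ - Real.cos α₁ =
      -(Complex.exp (α₂ * Complex.I) * (k - saddleAmpNorm l₁) +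
        (Complex.exp (α₂ * Complex.I) - Complex.exp (α₁ * Complex.I)) *
          (saddleAmpNorm l₁ - 1)).re := by
    have e : Complex.exp (α₂ * Complex.I) * (k - saddleAmpNorm l₁) +
        (Complex.exp (α₂ * Complex.I) - Complex.exp (α₁ * Complex.I)) * (saddleAmpNorm l₁ - 1) =
        Complex.exp (α₂ * Complex.I) * k - Complex.exp (α₁ * Complex.I) * saddleAmpNorm l₁ -
        (Complex.exp (α₂ * Complex.I) - Complex.exp (α₁ * Complex.I)) := by ring
    rw [e, Complex.sub_re, Complex.sub_re, hk2, hq1, Complex.sub_re, Complex.exp_ofReal_mul_I_re,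
      Complex.exp_ofReal_mul_I_re]
    ring
  rw [hid, abs_neg] at hcosd
  have hup := (Complex.abs_re_le_norm _).trans (norm_add_le
    (Complex.exp (α₂ * Complex.I) * (k - saddleAmpNorm l₁))
    ((Complex.exp (α₂ * Complex.I) - Complex.exp (α₁ * Complex.I)) * (saddleAmpNorm l₁ - 1)))
  rw [norm_mul, norm_mul, Complex.norm_exp_ofReal_mul_I, one_mul] at hup
  have h3 := mul_le_mul_of_nonneg_right (norm_exp_mul_I_sub_le α₂ α₁)
    (norm_nonneg (saddleAmpNorm l₁ - 1))
  have hpos : 0 < α₂ - α₁ := sub_pos.2 hlt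
  rw [abs_of_pos hpos] at h3 hcosd
  have hX : 0 ≤ c * (√l₁ * (2 / l₁ * saddleAmpAbs (l₁ / 2))) := by
    have : 0 ≤ saddleAmpAbs (l₁ / 2) :=
      MeasureTheory.integral_nonneg fun σ => by positivity
    positivity
  have h4 := mul_le_mul_of_nonneg_right hang hX
  have h5 := mul_lt_mul_of_pos_right hbd hpos
  linarith

/-! ### The sequence of zeros -/

/-- The set of positive zeros of `Q(0,0,·)`. -/
def swallowtailZeros : Set ℝ := {z : ℝ | 0 < z ∧ swallowtailQ 0 0 z = 0}

lemma mem_swallowtailZeros {z : ℝ} : z ∈ swallowtailZeros ↔ 0 < z ∧ swallowtailReal z = 0 := by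
  refine and_congr_right fun h => ?_
  rw [swallowtailQ_eq_real h.le, Complex.ofReal_eq_zero]

/-- If the function vanished identically, two distinct points of one far window would contradict
uniqueness. -/
lemma exists_swallowtailReal_ne_zero : ∃ z, swallowtailReal z ≠ 0 := by
  by_contra! h
  obtain ⟨Z, -, hu⟩ := exists_zero_unique one_pos (by linarith [Real.pi_gt_three])
  have hev : ∀ c : ℝ, ∀ᶠ m : ℕ in atTop, Z ≤ anglePlusInv ((2 * m + 1) * Real.pi / 2 + c) :=
    fun c => (tendsto_anglePlusInv.comp (tendsto_odd_half_pi c)).eventually_ge_atTop Z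
  obtain ⟨m, hm0, hm1⟩ := ((hev 0).and (hev (1 / 2))).exists
  have hm : (0 : ℝ) ≤ (2 * m + 1) * Real.pi / 2 := by have := Real.pi_pos; positivity
  have h0 : 0 ≤ (2 * m + 1) * Real.pi / 2 + 0 := by linarith
  have h1 : 0 ≤ (2 * m + 1) * Real.pi / 2 + 1 / 2 := by linarith
  have a0 := anglePlus_anglePlusInv h0
  have a1 := anglePlus_anglePlusInv h1
  have hlt := (strictMonoOn_anglePlus.lt_iff_lt (anglePlusInv_pos h0).le
    (anglePlusInv_pos h1).le).1 (by rw [a0, a1]; linarith)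
  refine hlt.ne (hu _ _ m hm0 hlt.le (h _) (h _) ?_ ?_)
  · rw [a0]; norm_num
  · rw [a1, add_sub_cancel_left]; norm_num

lemma finite_swallowtailZeros_inter_Iic (M : ℝ) : (swallowtailZeros ∩ Iic M).Finite := by
  by_contra hinf
  -- The compact interval contains 0: analyticity on the whole line also excludes accumulation
  -- there.
  have hsub : swallowtailZeros ∩ Iic M ⊆ Icc 0 M := fun z hz => ⟨hz.1.1.le, hz.2⟩
  obtain ⟨x, -, hx⟩ := Set.Infinite.exists_accPt_of_subset_isCompact hinf isCompact_Icc hsub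
  have hfr : ∃ᶠ z in 𝓝[≠] x, swallowtailReal z = 0 :=
    (accPt_iff_frequently_nhdsNE.1 hx).mono fun z hz => (mem_swallowtailZeros.1 hz.1).2
  have hz := analyticOnNhd_swallowtailReal.eqOn_zero_of_preconnected_of_frequently_eq_zero
    isPreconnected_univ (mem_univ x) hfr
  obtain ⟨z, h⟩ := exists_swallowtailReal_ne_zero
  exact h (hz (mem_univ z))

lemma infinite_swallowtailZeros : swallowtailZeros.Infinite := by
  intro hfin
  obtain ⟨M, hM⟩ := hfin.bddAbove
  obtain ⟨Z, hZ⟩ := eventually_atTop.1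
    (eventually_exists_zero one_pos (by linarith [Real.pi_gt_three]))
  have h1 := (tendsto_odd_half_pi (-1)).eventually_ge_atTop (anglePlus M)
  obtain ⟨m, hm, hmZ⟩ := (h1.and (eventually_ge_atTop Z)).exists
  obtain ⟨z, hz0, hz, hw⟩ := hZ m hmZ
  have hzM : z ≤ M := hM (mem_swallowtailZeros.2 ⟨hz0, hz⟩)
  have := (strictMonoOn_anglePlus.le_iff_le hz0.le (hz0.le.trans hzM)).2 hzM
  rw [abs_lt] at hw
  linarith [hw.1]

/-- An infinite set of reals with finite initial segments is enumerated in increasing order. -/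
lemma exists_strictMono_range_eq {Z : Set ℝ} (hinf : Z.Infinite)
    (hfin : ∀ M, (Z ∩ Iic M).Finite) : ∃ ζ : ℕ → ℝ, StrictMono ζ ∧ range ζ = Z := by
  have := hinf.to_subtype
  -- Counting the elements up to z embeds the set into ℕ in an order-preserving way, and an infinite
  -- subset of ℕ is order isomorphic to ℕ.
  let c : Z → ℕ := fun z => (Z ∩ Iic (z : ℝ)).ncard
  have hc : StrictMono c := by
    intro a b hab
    refine Set.ncard_lt_ncard ⟨inter_subset_inter_right _ (Iic_subset_Iic.2 hab.le), ?_⟩ (hfin _)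
    intro h
    exact absurd (h ⟨b.2, mem_Iic.2 le_rfl⟩).2 (not_le.2 hab)
  have hr : Infinite (range c) := (Set.infinite_range_of_injective hc.injective).to_subtype
  let e : ℕ ≃o range c := Nat.Subtype.orderIsoOfNat (range c)
  let f : ℕ ≃o Z := e.trans (hc.orderIso c).symm
  refine ⟨fun n => f n, fun a b h => f.strictMono h, ?_⟩
  ext z
  refine ⟨?_, fun hz => ⟨f.symm ⟨z, hz⟩, by simp⟩⟩
  rintro ⟨n, rfl⟩
  exact (f n).2

/-- Centres of distinct windows are at least π > 2 apart, so windows of radius 1 are disjoint and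
ordered. -/
lemma le_of_windows {x y : ℝ} {m n : ℕ} (hxy : x ≤ y)
    (hx : |x - (2 * m + 1) * Real.pi / 2| < 1) (hy : |y - (2 * n + 1) * Real.pi / 2| < 1) :
    m ≤ n := by
  by_contra! h
  have h1 : (n : ℝ) + 1 ≤ m := by exact_mod_cast h
  have h2 := mul_le_mul_of_nonneg_right h1 Real.pi_pos.le
  rw [abs_lt] at hx hy
  linarith [Real.pi_gt_three, hx.1, hy.2]

/-- If large terms of an increasing sequence are located one by one in the windows around the odd
multiples of `π / 2`, then the `n`-th term is at a bounded distance from the `n`-th one. -/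
lemma exists_bound_of_windows {a : ℕ → ℝ} (ha : StrictMono a) (hlim : Tendsto a atTop atTop)
    (hw : ∀ᶠ m : ℕ in atTop, ∃! n, |a n - (2 * m + 1) * Real.pi / 2| < 1)
    (hall : ∀ᶠ n : ℕ in atTop, ∃ m : ℕ, |a n - (2 * m + 1) * Real.pi / 2| < 1) :
    ∃ C, ∀ᶠ n : ℕ in atTop, |a n - (2 * n + 1) * Real.pi / 2| ≤ C := by
  obtain ⟨M, hM⟩ := eventually_atTop.1 hw
  obtain ⟨N, hN⟩ := eventually_atTop.1
    (hall.and (hlim.eventually_ge_atTop ((2 * M + 1) * Real.pi / 2)))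
  choose! μ hμ using fun n hn => (hN n hn).1
  have hμM : ∀ n, N ≤ n → M ≤ μ n := fun n hn =>
    le_of_windows (hN n hn).2 (by simp) (hμ n hn)
  -- No window is used twice, by uniqueness, and none is skipped: the term in the next window has an
  -- index above n.
  have hstep : ∀ n, N ≤ n → μ (n + 1) = μ n + 1 := by
    intro n hn
    have hn1 : N ≤ n + 1 := hn.trans n.le_succ
    have hle : μ n ≤ μ (n + 1) := le_of_windows (ha n.lt_succ_self).le (hμ n hn) (hμ _ hn1)
    have hne : μ n ≠ μ (n + 1) := by
      intro h
      have h1 := hμ _ hn1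
      rw [← h] at h1
      have := (hM (μ n) (hμM n hn)).unique (hμ n hn) h1
      omega
    obtain ⟨j, hj, -⟩ := hM (μ n + 1) ((hμM n hn).trans (Nat.le_succ _))
    have hnj : n < j := by
      by_contra! h
      have := le_of_windows (ha.monotone h) hj (hμ n hn)
      omega
    have := le_of_windows (m := μ (n + 1)) (ha.monotone (Nat.succ_le_of_lt hnj)) (hμ _ hn1) hj
    omega
  have hind : ∀ k, μ (N + k) = μ N + k := by
    intro k
    induction k with
    | zero => rfl
    | succ k ih => rw [← add_assoc, hstep _ (Nat.le_add_right _ _), ih]; ring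
  -- The window index exceeds n by the fixed integer `μ N` - N, which may be negative and is not
  -- computed; each unit shifts the centre by π.
  refine ⟨1 + |(μ N : ℝ) - N| * Real.pi, eventually_atTop.2 ⟨N, fun n hn => ?_⟩⟩
  obtain ⟨k, rfl⟩ := Nat.exists_eq_add_of_le hn
  have h1 := hμ _ hn
  rw [hind] at h1
  push_cast at h1 ⊢
  have e : a (N + k) - (2 * (N + k) + 1) * Real.pi / 2 =
      (a (N + k) - (2 * (μ N + k) + 1) * Real.pi / 2) + ((μ N : ℝ) - N) * Real.pi := by ring
  rw [e]
  refine (abs_add_le _ _).trans ?_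
  rw [abs_mul, abs_of_pos Real.pi_pos]
  linarith

lemma existsUnique_zero {ε : ℝ} (h0 : 0 < ε) (h1 : ε < Real.pi / 2) :
    ∀ᶠ m : ℕ in atTop, ∃! z : ℝ, 0 < z ∧ swallowtailQ 0 0 z = 0 ∧
      |anglePlus z - (2 * m + 1) * Real.pi / 2| < ε := by
  obtain ⟨Z, hZ0, hZ⟩ := exists_zero_unique h0 h1
  filter_upwards [eventually_exists_zero h0 h1,
    (tendsto_odd_half_pi (-ε)).eventually_ge_atTop (anglePlus Z)] with m hm hmZ
  obtain ⟨z, hz0, hz, hzw⟩ := hm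
  have hlarge : ∀ y : ℝ, 0 < y → |anglePlus y - (2 * m + 1) * Real.pi / 2| < ε → Z ≤ y := by
    intro y hy hyw
    rw [abs_lt] at hyw
    rw [← strictMonoOn_anglePlus.le_iff_le hZ0.le hy.le]
    linarith [hyw.1]
  refine ⟨z, ⟨hz0, (mem_swallowtailZeros.2 ⟨hz0, hz⟩).2, hzw⟩, ?_⟩
  rintro y ⟨hy0, hy, hyw⟩
  have hy' := (mem_swallowtailZeros.1 ⟨hy0, hy⟩).2
  rcases le_total y z with h | h
  · exact hZ y z m (hlarge y hy0 hyw) h hy' hz hyw hzw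
  · exact (hZ z y m (hlarge z hz0 hzw) h hz hy' hzw hyw).symm

lemma eventually_swallowtailQ_zero_near {ε : ℝ} (h0 : 0 < ε) (h1 : ε < Real.pi / 2) :
    ∀ᶠ z : ℝ in atTop, swallowtailQ 0 0 z = 0 →
      ∃ m : ℕ, |anglePlus z - (2 * m + 1) * Real.pi / 2| < ε := by
  filter_upwards [eventually_zero_near h0 h1, eventually_gt_atTop 0] with z hz hz0 hq
  exact hz (mem_swallowtailZeros.1 ⟨hz0, hq⟩).2

lemma tendsto_atTop_of_strictMono_of_finite {ζ : ℕ → ℝ} (hζ : StrictMono ζ)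
    (hfin : ∀ M, (range ζ ∩ Iic M).Finite) : Tendsto ζ atTop atTop := by
  refine tendsto_atTop_atTop_of_monotone hζ.monotone fun M => ?_
  by_contra! h
  refine Set.infinite_range_of_injective hζ.injective ((hfin M).subset ?_)
  rintro _ ⟨n, rfl⟩
  exact ⟨⟨n, rfl⟩, (h n).le⟩

/-- A bounded error in the angle disappears in the ratio, and the power 4/5 preserves the limit 1.
-/
lemma isEquivalent_anglePlusInv {a : ℕ → ℝ} {C : ℝ} (ha : ∀ᶠ n in atTop, 0 ≤ a n)
    (h : ∀ᶠ n : ℕ in atTop, |a n - (2 * n + 1) * Real.pi / 2| ≤ C) :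
    (fun n => anglePlusInv (a n)) ~[atTop] approxZeroPlus := by
  have hpi := Real.pi_pos
  have hpos : ∀ n : ℕ, 0 < Real.pi / 8 + (2 * n + 1) * Real.pi / 2 := fun n => by positivity
  have hden : Tendsto (fun n : ℕ => Real.pi / 8 + (2 * n + 1) * Real.pi / 2) atTop atTop := by
    simpa only [add_comm] using tendsto_odd_half_pi (Real.pi / 8)
  have hratio : Tendsto (fun n : ℕ => (Real.pi / 8 + a n) /
      (Real.pi / 8 + (2 * n + 1) * Real.pi / 2)) atTop (𝓝 1) := by
    have hz : Tendsto (fun n : ℕ => (a n - (2 * n + 1) * Real.pi / 2) /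
        (Real.pi / 8 + (2 * n + 1) * Real.pi / 2)) atTop (𝓝 0) := by
      refine squeeze_zero_norm' ?_ (tendsto_const_nhds (x := C).div_atTop hden)
      filter_upwards [h] with n hn
      rw [norm_div, Real.norm_eq_abs, Real.norm_of_nonneg (hpos n).le]
      exact div_le_div_of_nonneg_right hn (hpos n).le
    have := hz.const_add 1
    rw [add_zero] at this
    refine this.congr fun n => ?_
    have := (hpos n).ne'
    field_simp
    ring
  rw [isEquivalent_iff_tendsto_one (Eventually.of_forall fun n => by
    have := hpos n
    unfold approxZeroPlus
    positivity)]
  have hr := hratio.rpow_const (p := (4 / 5 : ℝ)) (Or.inl one_ne_zero)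
  rw [Real.one_rpow] at hr
  refine hr.congr' ?_
  filter_upwards [ha] with n hn
  have := hpos n
  rw [Pi.div_apply, anglePlusInv, approxZeroPlus, ← Real.div_rpow (by positivity) (by positivity)]
  congr 1
  field_simp

theorem exists_zeros_enumeration : ∃ ζ : ℕ → ℝ, StrictMono ζ ∧
    range ζ = {z : ℝ | 0 < z ∧ swallowtailQ 0 0 z = 0} ∧ ζ ~[atTop] approxZeroPlus := by
  obtain ⟨ζ, hmono, hrange⟩ := exists_strictMono_range_eq infinite_swallowtailZeros
    finite_swallowtailZeros_inter_Iic
  refine ⟨ζ, hmono, hrange, ?_⟩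
  have hmem : ∀ n, 0 < ζ n ∧ swallowtailQ 0 0 (ζ n) = 0 := fun n => by
    have : ζ n ∈ swallowtailZeros := hrange ▸ mem_range_self n
    exact this
  have hlim : Tendsto ζ atTop atTop := tendsto_atTop_of_strictMono_of_finite hmono
    (hrange ▸ finite_swallowtailZeros_inter_Iic)
  have h1 : (1 : ℝ) < Real.pi / 2 := by linarith [Real.pi_gt_three]
  have hamono : StrictMono fun n => anglePlus (ζ n) := fun m n h =>
    strictMonoOn_anglePlus (hmem m).1.le (hmem n).1.le (hmono h)
  have halim := tendsto_anglePlus.comp hlim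
  obtain ⟨C, hC⟩ := exists_bound_of_windows hamono halim (by
    filter_upwards [existsUnique_zero one_pos h1] with m hm
    obtain ⟨z, ⟨hz0, hz, hzw⟩, hu⟩ := hm
    obtain ⟨n, rfl⟩ : z ∈ range ζ := hrange ▸ (⟨hz0, hz⟩ : z ∈ swallowtailZeros)
    exact ⟨n, hzw, fun k hk => hmono.injective (hu _ ⟨(hmem k).1, (hmem k).2, hk⟩)⟩) (by
    filter_upwards [hlim.eventually (eventually_swallowtailQ_zero_near one_pos h1)] with n hn
    exact hn (hmem n).2)
  have := isEquivalent_anglePlusInv (halim.eventually_ge_atTop 0) hC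
  refine this.congr_left (Eventually.of_forall fun n => ?_)
  exact anglePlusInv_anglePlus (hmem n).1.le

theorem mainTheorem1 :
    -- the improper integral defining `Q(0,0,z)` converges
    (∀ z : ℝ, 0 < z →
      Tendsto (fun p : ℝ × ℝ => swallowtailTrunc 0 0 z p.1 p.2) (atBot ×ˢ atTop)
        (𝓝 (swallowtailQ 0 0 z))) ∧
    -- the saddles of the phase are `t_0, t_1, t_2, t_3`
    (∀ t : ℂ, deriv phasePlus t = 0 ↔ ∃ k < 4, t = saddlePlus k) ∧
    -- the two saddles `t_0 = e^{πi/4}` and `t_1 = e^{3πi/4}` contribute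
    (∃ γ₀ γ₁ : ℝ → ℂ,
      IsSteepestDescentPath (fun t => Complex.I * phasePlus t) (saddlePlus 0) γ₀ ∧
      IsSteepestDescentPath (fun t => Complex.I * phasePlus t) (saddlePlus 1) γ₁ ∧
      TendsToInftyDir γ₁ atBot (9 * Real.pi / 10) ∧ TendsToInftyDir γ₁ atTop (Real.pi / 2) ∧
      TendsToInftyDir γ₀ atBot (Real.pi / 2) ∧ TendsToInftyDir γ₀ atTop (Real.pi / 10) ∧
      (∀ lam : ℝ, 0 < lam →
        MeasureTheory.Integrable (pathIntegrand γ₀ lam) ∧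
        MeasureTheory.Integrable (pathIntegrand γ₁ lam)) ∧
      (∀ z : ℝ, 0 < z → swallowtailQ 0 0 z =
        (z ^ (1 / 4 : ℝ) : ℝ) *
          (pathIntegral γ₁ (z ^ (5 / 4 : ℝ)) + pathIntegral γ₀ (z ^ (5 / 4 : ℝ)))) ∧
      pathIntegral γ₀ ~[atTop] saddleContribution (saddlePlus 0) ∧
      pathIntegral γ₁ ~[atTop] saddleContribution (saddlePlus 1)) ∧
    -- the leading-order asymptotics of `Q(0,0,z)`
    ((fun z : ℝ => swallowtailQ 0 0 z - ((amplitudePlus z * Real.cos (anglePlus z) : ℝ) : ℂ))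
      =o[atTop] amplitudePlus) ∧
    -- the positive zeroes, in increasing order, are asymptotic to the approximate zeroes
    (∃ ζ : ℕ → ℝ, StrictMono ζ ∧ range ζ = {z : ℝ | 0 < z ∧ swallowtailQ 0 0 z = 0} ∧
      ζ ~[atTop] approxZeroPlus) ∧
    -- sharp location: for large `m` one zero close to the `m`-th zero of the cosine,
    -- and no other large zeroes
    (∀ ε : ℝ, 0 < ε → ε < Real.pi / 2 →
      (∀ᶠ m : ℕ in atTop, ∃! z : ℝ, 0 < z ∧ swallowtailQ 0 0 z = 0 ∧
        |anglePlus z - (2 * m + 1) * Real.pi / 2| < ε) ∧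
      (∀ᶠ z : ℝ in atTop, swallowtailQ 0 0 z = 0 →
        ∃ m : ℕ, |anglePlus z - (2 * m + 1) * Real.pi / 2| < ε)) := by
  refine ⟨fun z hz => ?_, deriv_phasePlus_eq_zero_iff, ⟨descentCurve, descentCurveRefl,
    isSteepestDescentPath_descentCurve, isSteepestDescentPath_descentCurveRefl,
    tendsToInftyDir_descentCurveRefl_atBot, tendsToInftyDir_descentCurveRefl_atTop,
    tendsToInftyDir_descentCurve_atBot, tendsToInftyDir_descentCurve_atTop,
    fun lam hl => ⟨integrable_pathIntegrand_descentCurve hl,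
      integrable_pathIntegrand_descentCurveRefl hl⟩, fun z hz => ?_,
    pathIntegral_descentCurve_isEquivalent, pathIntegral_descentCurveRefl_isEquivalent⟩,
    swallowtailQ_asymptotics, exists_zeros_enumeration, fun ε h0 h1 =>
      ⟨existsUnique_zero h0 h1, eventually_swallowtailQ_zero_near h0 h1⟩⟩
  · rw [swallowtailQ_eq_half hz.le]
    exact tendsto_swallowtailTrunc hz.le
  · rw [swallowtailQ_eq_pathIntegral hz, pathIntegral_descentCurveRefl, add_comm, Complex.add_conj,
      ← Complex.ofReal_mul]
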